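/- For $t \ge 1$ let $n = 2^t-1$, $q = 2^{2t}$, $\mathtt N = q-1$, $m = \mathtt N/n = 2^t+1$, let $\gamma$ be any generator of $\mathbb F_q^*$, and let $\Sigma = \mathbb F_q^m$. Let $C_n \subseteq \Sigma^n$ be the folded Reed–Solomon code of degree $k = \lfloor 0.1\,\mathtt N\rfloor$: its codewords are the vectors $(f(1), f(\gamma), \dots, f(\gamma^{\mathtt N-1}))$, for polynomials $f$ over $\mathbb F_q$ of degree at most $k$, cut into $n$ consecutive blocks of length $m$. Let $C_n^\perp \subseteq \Sigma^n$ be its dual with respect to the standard bilinear form on $\mathbb F_q^{\mathtt N} \cong \Sigma^n$. Then: 1. (List-recoverability.) For all sufficiently large $t$ and every generator $\gamma$, $C_n$ is $(0.4,\, 2^{n^{0.8}},\, 2^{n^{0.9}})$-list-recoverable. That is, for all $S_1,\dots,S_n \subseteq \Sigma$ with $|S_i| \le 2^{n^{0.8}}$ for every $i$, at most $2^{n^{0.9}}$ codewords $x \in C_n$ satisfy $|\{i : x_i \in S_i\}| \ge 0.4\,n$. 2. (Unique decodability of the dual.) There is a deterministic algorithm $\mathsf{Decode}$ that, given $n$,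 the addition and multiplication tables of $\mathbb F_q$ under an arbitrary numbering $0,\dots,q-1$ of its elements, the generator $\gamma$ and a word $z \in \Sigma^n$, outputs a word $\mathsf{Decode}(z) \in \Sigma^n$ in time $\mathrm{poly}(n)$, and there are a constant $c>0$ and a $t_0$ such that for all $t \ge t_0$, every such presentation of $\mathbb F_q$, every generator $\gamma$ and every $0 \le p \le 0.04$, $$\Pr_{e \sim \mathcal D_n}\bigl[\forall x \in C_n^\perp,\ \mathsf{Decode}(x+e) = x\bigr] \ \ge\ 1 - 2^{-cn}.$$ Here $\mathcal D_n$ is the product distribution on $\Sigma^n$ in which each symbol is $0$ with probability $1-p$ and otherwise a uniformly random element of $\Sigma\setminus\{0\}$. Time is counted on a unit-cost random access machine over the natural numbers with addition and truncated subtraction. -/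

import Mathlib

/-! ### Error-correcting codes -/

/-- The Reed–Solomon code of length `N` and degree `k`: all vectors
`(f (γ ^ 0), f (γ ^ 1), …, f (γ ^ (N - 1)))` with `f` a polynomial of degree at most `k`. -/
def rsCode {F : Type} [Field F] (N k : ℕ) (γ : Fˣ) : Set (Fin N → F) :=
  {x | ∃ f : Polynomial F, f.natDegree ≤ k ∧ ∀ i : Fin N, x i = f.eval ((γ : F) ^ (i : ℕ))}

/-- Folding: `n * m` consecutive letters are grouped into `n` blocks of `m` letters; the `j`-th
letter of block `i` is the letter with index `m * i + j`. -/
def foldWord {F : Type} {n m : ℕ} (x : Fin (n * m) → F) : Fin n → Fin m → F :=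
  fun i j => x (finProdFinEquiv (i, j))

/-- The `m`-folded code, of length `n` over the alphabet `Fin m → F`. -/
def foldedCode {F : Type} {n m : ℕ} (C : Set (Fin (n * m) → F)) : Set (Fin n → Fin m → F) :=
  foldWord '' C

/-- The dual of a folded code, with respect to the standard bilinear form over `F`
on all `n * m` letters. -/
def dualCode {F : Type} [Field F] {n m : ℕ} (C : Set (Fin n → Fin m → F)) :
    Set (Fin n → Fin m → F) :=
  {y | ∀ x ∈ C, ∑ i, ∑ j, y i j * x i j = 0}

open Classical in
/-- `(ζ, ℓ, L)`-list-recoverability of a code of length `n` over a finite alphabet `A`. -/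
def IsListRecoverable {A : Type} [Finite A] {n : ℕ} (C : Set (Fin n → A)) (ζ ℓ L : ℝ) : Prop :=
  ∀ S : Fin n → Finset A, (∀ i, ((S i).card : ℝ) ≤ ℓ) →
    (({x ∈ C | ζ * n ≤ ((Finset.univ.filter fun i => x i ∈ S i).card : ℝ)}.ncard : ℕ) : ℝ) ≤ L

/-! ### The parameters of the code: `q = 2 ^ (2 * t)` -/

/-- The length `n = 2 ^ t - 1` of the folded code. -/
def codeLen (t : ℕ) : ℕ := 2 ^ t - 1

/-- The folding parameter `m = 2 ^ t + 1`. -/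
def foldParam (t : ℕ) : ℕ := 2 ^ t + 1

/-- The unfolded length `N = n * m`. -/
def rsLen (t : ℕ) : ℕ := codeLen t * foldParam t

theorem rsLen_eq (t : ℕ) : rsLen t = 2 ^ (2 * t) - 1 := by
  have h := Nat.sq_sub_sq (2 ^ t) 1
  rw [rsLen, codeLen, foldParam, Nat.mul_comm (2 ^ t - 1), ← h, pow_mul', one_pow]

/-- The words of length `n` over the alphabet `Fin m → F`. -/
abbrev Word (t : ℕ) (F : Type) : Type := Fin (codeLen t) → Fin (foldParam t) → F

/-- The folded Reed–Solomon code `C_n`. The natural-number quotient is the floor of `0.1 * N`: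
a polynomial has degree at most `0.1 * N` if and only if it has degree at most this floor. -/
def frsCode {F : Type} [Field F] (t : ℕ) (γ : Fˣ) : Set (Word t F) :=
  foldedCode (rsCode (rsLen t) (rsLen t / 10) γ)

/-! ### The error distribution -/

open Classical in
/-- The probability of the symbol `s` if a symbol is `0` with probability `1 - p` and otherwise
uniform on the nonzero elements of the alphabet. -/
noncomputable def symbolProb {F : Type} [Field F] [Fintype F] {m : ℕ} (p : ℝ) (s : Fin m → F) : ℝ :=
  if s = 0 then 1 - p else p / ((Fintype.card (Fin m → F) : ℝ) - 1)

open Classical in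
/-- The probability of the event `E` under the product distribution of `n` such symbols. -/
noncomputable def errorProb {F : Type} [Field F] [Fintype F] {n m : ℕ} (p : ℝ)
    (E : Set (Fin n → Fin m → F)) : ℝ :=
  ∑ e : Fin n → Fin m → F, if e ∈ E then ∏ i, symbolProb p (e i) else 0

/-! ### Random access machines

Unit-cost random access machine with addition and truncated subtraction on natural
numbers and with indirect addressing, programmed by structured programs. There is no
multiplication instruction, so that numbers grow by at most one bit in a step and
unit-cost time is polynomially related to the running time of Turing machines. -/

/-- Programs; register names are natural numbers. -/
inductive RAMProgram : Type
  /-- no operation -/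
  | skip : RAMProgram
  /-- `x := c` -/
  | const (x c : ℕ) : RAMProgram
  /-- `x := y + z` -/
  | add (x y z : ℕ) : RAMProgram
  /-- `x := y - z` (truncated at `0`) -/
  | sub (x y z : ℕ) : RAMProgram
  /-- `x := mem[y]` -/
  | load (x y : ℕ) : RAMProgram
  /-- `mem[x] := y` -/
  | store (x y : ℕ) : RAMProgram
  /-- sequential composition -/
  | seq (P Q : RAMProgram) : RAMProgram
  /-- `if x ≠ 0 then P else Q` -/
  | branch (x : ℕ) (P Q : RAMProgram) : RAMProgram
  /-- `while x ≠ 0 do P` -/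
  | loop (x : ℕ) (P : RAMProgram) : RAMProgram

/-- The contents of the registers and of the memory. -/
structure RAMState : Type where
  reg : ℕ → ℕ
  mem : ℕ → ℕ

/-- Assignment of the value `v` to the register `x`. -/
def RAMState.setReg (s : RAMState) (x v : ℕ) : RAMState :=
  { s with reg := Function.update s.reg x v }

/-- Assignment of the value `v` to the memory cell with address `a`. -/
def RAMState.setMem (s : RAMState) (a v : ℕ) : RAMState :=
  { s with mem := Function.update s.mem a v }

/-- `RAMExec P s u τ`: the program `P`, started in state `s`, halts in state `u` after exactly `τ`
steps. Each elementary instruction and each test counts as one step. -/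
inductive RAMExec : RAMProgram → RAMState → RAMState → ℕ → Prop
  | skip (s : RAMState) : RAMExec .skip s s 1
  | const (x c : ℕ) (s : RAMState) : RAMExec (.const x c) s (s.setReg x c) 1
  | add (x y z : ℕ) (s : RAMState) :
      RAMExec (.add x y z) s (s.setReg x (s.reg y + s.reg z)) 1
  | sub (x y z : ℕ) (s : RAMState) :
      RAMExec (.sub x y z) s (s.setReg x (s.reg y - s.reg z)) 1
  | load (x y : ℕ) (s : RAMState) :
      RAMExec (.load x y) s (s.setReg x (s.mem (s.reg y))) 1
  | store (x y : ℕ) (s : RAMState) :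
      RAMExec (.store x y) s (s.setMem (s.reg x) (s.reg y)) 1
  | seq {P Q : RAMProgram} {s u v : RAMState} {τ σ : ℕ} :
      RAMExec P s u τ → RAMExec Q u v σ → RAMExec (.seq P Q) s v (τ + σ)
  | branch_true {x : ℕ} {P Q : RAMProgram} {s u : RAMState} {τ : ℕ} :
      s.reg x ≠ 0 → RAMExec P s u τ → RAMExec (.branch x P Q) s u (τ + 1)
  | branch_false {x : ℕ} {P Q : RAMProgram} {s u : RAMState} {τ : ℕ} :
      s.reg x = 0 → RAMExec Q s u τ → RAMExec (.branch x P Q) s u (τ + 1)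
  | loop_true {x : ℕ} {P : RAMProgram} {s u v : RAMState} {τ σ : ℕ} :
      s.reg x ≠ 0 → RAMExec P s u τ → RAMExec (.loop x P) u v σ →
        RAMExec (.loop x P) s v (τ + σ + 1)
  | loop_false {x : ℕ} {P : RAMProgram} {s : RAMState} :
      s.reg x = 0 → RAMExec (.loop x P) s s 1

/-- Machines are deterministic: final state and step count are determined by the initial state. -/
theorem RAMExec.deterministic {P : RAMProgram} {s u v : RAMState} {τ σ : ℕ}
    (h : RAMExec P s u τ) (k : RAMExec P s v σ) : u = v ∧ τ = σ := by
  induction h generalizing v σ with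
  | skip | const | add | sub | load | store => cases k; exact ⟨rfl, rfl⟩
  | seq _ _ ih₁ ih₂ =>
    cases k with
    | seq a b =>
      obtain ⟨rfl, rfl⟩ := ih₁ a
      obtain ⟨rfl, rfl⟩ := ih₂ b
      exact ⟨rfl, rfl⟩
  | branch_true hx _ ih =>
    cases k with
    | branch_true _ a => obtain ⟨rfl, rfl⟩ := ih a; exact ⟨rfl, rfl⟩
    | branch_false h0 _ => exact absurd h0 hx
  | branch_false hx _ ih =>
    cases k with
    | branch_true h0 _ => exact absurd hx h0
    | branch_false _ a => obtain ⟨rfl, rfl⟩ := ih a; exact ⟨rfl, rfl⟩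
  | loop_true hx _ _ ih₁ ih₂ =>
    cases k with
    | loop_true _ a b =>
      obtain ⟨rfl, rfl⟩ := ih₁ a
      obtain ⟨rfl, rfl⟩ := ih₂ b
      exact ⟨rfl, rfl⟩
    | loop_false h0 => exact absurd h0 hx
  | loop_false hx =>
    cases k with
    | loop_true h0 _ _ => exact absurd hx h0
    | loop_false _ => exact ⟨rfl, rfl⟩

/-- Initially the input is in the memory cells `0, 1, 2, …`; everything else is `0`. -/
def RAMState.initial (input : List ℕ) : RAMState where
  reg := fun _ => 0
  mem := fun a => input.getD a 0

/-- On the given input, `P` halts after at most `T` steps, with the given output in the memory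
cells `0, 1, 2, …`. -/
def RAMProgram.OutputsWithin (P : RAMProgram) (T : ℕ) (input output : List ℕ) : Prop :=
  ∃ (u : RAMState) (τ : ℕ), RAMExec P (RAMState.initial input) u τ ∧ τ ≤ T ∧
    ∀ (a : ℕ) (h : a < output.length), u.mem a = output[a]

/-! ### Encoding of the input and the output of a decoder

The field elements are numbered by an arbitrary bijection `ν` onto `{0, …, q - 1}`. -/

/-- The table of a binary operation of the field, row by row (`q * q` numbers). -/
def tableList {F : Type} {q : ℕ} (ν : F ≃ Fin q) (op : F → F → F) : List ℕ :=
  List.ofFn fun a : Fin (q * q) => (ν (op (ν.symm a.divNat) (ν.symm a.modNat)) : ℕ)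

/-- The `N` letters of a word, block after block. -/
def wordList {F : Type} {q t : ℕ} (ν : F ≃ Fin q) (z : Word t F) : List ℕ :=
  List.ofFn fun a : Fin (codeLen t * foldParam t) => (ν (z a.divNat a.modNat) : ℕ)

/-- The input of a decoder: the length `n`, the generator `γ`, the addition table and the
multiplication table of the field, and the received word `z`. -/
def decoderInput {F : Type} [Field F] {q t : ℕ} (ν : F ≃ Fin q) (γ : Fˣ) (z : Word t F) :
    List ℕ :=
  [codeLen t, (ν (γ : F) : ℕ)] ++ tableList ν (· + ·) ++ tableList ν (· * ·) ++ wordList ν z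

/-! List-recoverability is proved by interpolation with multiplicities. Let `q = N + 1` be the size
of the field. Every candidate symbol of a block is cut into windows of `s` consecutive letters; a
window starting at `γ ^ a` would consist of the values at this point of `f(X), f(γX), …, f(γ^(s-1)
X)`. By a dimension count (`exists_interpolant`) there is a nonzero `Q(X, Y₁, …, Yₛ)`, of degree
less than `N` in `X` and at most `w` in the `Y`s, that vanishes to order `r` at all windows. If `f`
agrees with enough blocks, then `Q(X, f(X), f(γX), …)` has more zeros than its degree allows, so it
is zero. Now take `α` in the algebraic closure with `α ^ q = γ α`. Frobenius gives `f(γ^j α) = f(α)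
^ (q^j)`, so `f(α)` is a root of a univariate polynomial of degree at most `w q^(s-1)`. That
polynomial is nonzero because base-`q` digits are unique and because `α` has `N` distinct
conjugates, so no nonzero polynomial of degree less than `N` over the field vanishes at it
(`exists_finset_aeval_mem`). For the same reason `f(α)` determines `f`, which bounds the list
(`ncard_frsCode_le`). It remains to choose `s`, `r`, `w` proportional to `n ^ 0.8`.

For the dual code, a dual word `x` satisfies `∑ xᵢ γ^(i d) = 0` for all `d ≤ k`. Hence the Hankel
matrix of syndromes of `x + e`, with row and column exponents below `q / 20`, depends only on `e`.
It factors as `Uᵀ diag(e) U` with `U` of Vandermonde type, so as long as there are few errors its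
rank is the number of wrong letters (`rank_syndromeMatrix`). Adding `v` to one letter lowers the
rank exactly when this corrects a wrong letter (`IsDecodedLetter.eq_sub`); each letter is therefore
decoded separately by trying all `v`. A Chernoff bound (`exists_le_errorProb`) shows that more than
`n / 20` wrong symbols are exponentially unlikely.

To obtain a machine, the decoder is written in a small language whose loops all have length `q`. A
verified compiler (`ArrStmt.exec_compile`) and a polynomial bound for the cost
(`ArrStmt.exists_cost_le`) hold for every program of this language. Ranks are computed by
division-free rank reduction, so table lookups for addition and multiplication suffice. -/

/-! ### A language of bounded loops over arrays -/

/-- Expressions: numbers built from constants, the global bound `size`, variables, the input memory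
and eight arrays. -/
inductive ArrExpr : Type
  | lit (c : ℕ) : ArrExpr
  | size : ArrExpr
  | var (x : ℕ) : ArrExpr
  | add (a b : ArrExpr) : ArrExpr
  | sub (a b : ArrExpr) : ArrExpr
  /-- multiplication by `size` -/
  | scale (a : ArrExpr) : ArrExpr
  /-- a cell of the input memory -/
  | inp (a : ArrExpr) : ArrExpr
  /-- an entry of an array -/
  | get (k : Fin 8) (a : ArrExpr) : ArrExpr

/-- Statements; all loops run `size` times. -/
inductive ArrStmt : Type
  | skip : ArrStmt
  | set (x : ℕ) (a : ArrExpr) : ArrStmt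
  | put (k : Fin 8) (a b : ArrExpr) : ArrStmt
  /-- write to the input memory -/
  | out (a b : ArrExpr) : ArrStmt
  | seq (P Q : ArrStmt) : ArrStmt
  | ite (a : ArrExpr) (P Q : ArrStmt) : ArrStmt
  | loop (x : ℕ) (P : ArrStmt) : ArrStmt

/-- The states of array programs. -/
structure ArrEnv : Type where
  size : ℕ
  base : ℕ
  var : ℕ → ℕ
  inp : ℕ → ℕ
  arr : Fin 8 → ℕ → ℕ

namespace ArrEnv

def setVar (e : ArrEnv) (x v : ℕ) : ArrEnv := { e with var := Function.update e.var x v }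

def setArr (e : ArrEnv) (k : Fin 8) (i v : ℕ) : ArrEnv :=
  { e with arr := Function.update e.arr k (Function.update (e.arr k) i v) }

def setInp (e : ArrEnv) (i v : ℕ) : ArrEnv :=
  if i < e.base then { e with inp := Function.update e.inp i v } else e

end ArrEnv

/-- `forIter f n e` is `f (n - 1) (… (f 1 (f 0 e)))`. -/
def forIter {α : Type} (f : ℕ → α → α) : ℕ → α → α
  | 0, e => e
  | i + 1, e => f i (forIter f i e)

namespace ArrExpr

def eval : ArrExpr → ArrEnv → ℕ
  | lit c, _ => c
  | size, e => e.size
  | var x, e => e.var x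
  | add a b, e => a.eval e + b.eval e
  | sub a b, e => a.eval e - b.eval e
  | scale a, e => a.eval e * e.size
  | inp a, e => if a.eval e < e.base then e.inp (a.eval e) else 0
  | get k a, e => e.arr k (a.eval e)

/-- An upper bound for the number of steps of the evaluation, in terms of `size`. -/
def cost (M : ℕ) : ArrExpr → ℕ
  | lit _ => 1
  | size => 2
  | var _ => 2
  | add a b => a.cost M + b.cost M + 1
  | sub a b => a.cost M + b.cost M + 1
  | scale a => a.cost M + 5 + (3 * M + 1)
  | inp a => a.cost M + 3
  | get _ a => a.cost M + 7

end ArrExpr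

namespace ArrStmt

def run : ArrStmt → ArrEnv → ArrEnv
  | skip, e => e
  | set x a, e => e.setVar x (a.eval e)
  | put k a b, e => e.setArr k (a.eval e) (b.eval e)
  | out a b, e => e.setInp (a.eval e) (b.eval e)
  | seq P Q, e => Q.run (P.run e)
  | ite a P Q, e => if a.eval e ≠ 0 then P.run e else Q.run e
  | .loop x P, e => forIter (fun i u => P.run (u.setVar x i)) e.size e

/-- An upper bound for the number of steps, in terms of `size`. -/
def cost (M : ℕ) : ArrStmt → ℕ
  | skip => 1
  | set _ a => a.cost M + 2
  | put _ a b => a.cost M + b.cost M + 7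
  | out a b => a.cost M + b.cost M + 3
  | seq P Q => P.cost M + Q.cost M
  | ite a P Q => a.cost M + P.cost M + Q.cost M + 1
  | .loop _ P => 3 + M * (P.cost M + 7)

end ArrStmt

/-! ### Compilation -/

/-- The register of a variable. -/
def varReg (x : ℕ) : ℕ := 2 * x + 4

/-- The temporary registers. -/
def tempReg (d : ℕ) : ℕ := 2 * d + 1

namespace ArrExpr

/-- Code that evaluates an expression into the temporary register `d`, using only the temporary
registers from `d` on. -/
def compile : ArrExpr → ℕ → RAMProgram
  | lit c, d => .const (tempReg d) c
  | size, d => .seq (.const (tempReg d) 0) (.add (tempReg d) (tempReg d) 0)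
  | var x, d => .seq (.const (tempReg d) 0) (.add (tempReg d) (tempReg d) (varReg x))
  | add a b, d => .seq (a.compile d) (.seq (b.compile (d + 1))
      (.add (tempReg d) (tempReg d) (tempReg (d + 1))))
  | sub a b, d => .seq (a.compile d) (.seq (b.compile (d + 1))
      (.sub (tempReg d) (tempReg d) (tempReg (d + 1))))
  | scale a, d => .seq (a.compile (d + 1)) (.seq (.const (tempReg d) 0)
      (.seq (.const (tempReg (d + 2)) 1) (.seq (.const (tempReg (d + 3)) 0)
      (.seq (.add (tempReg (d + 3)) (tempReg (d + 3)) 0)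
      (.loop (tempReg (d + 3)) (.seq (.add (tempReg d) (tempReg d) (tempReg (d + 1)))
        (.sub (tempReg (d + 3)) (tempReg (d + 3)) (tempReg (d + 2)))))))))
  | inp a, d => .seq (a.compile d) (.seq (.sub (tempReg (d + 1)) 2 (tempReg d))
      (.branch (tempReg (d + 1)) (.load (tempReg d) (tempReg d)) (.const (tempReg d) 0)))
  | get k a, d => .seq (a.compile d) (.seq (.add (tempReg d) (tempReg d) (tempReg d))
      (.seq (.add (tempReg d) (tempReg d) (tempReg d))
      (.seq (.add (tempReg d) (tempReg d) (tempReg d)) (.seq (.const (tempReg (d + 1)) k)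
      (.seq (.add (tempReg d) (tempReg d) (tempReg (d + 1)))
      (.seq (.add (tempReg d) (tempReg d) 2) (.load (tempReg d) (tempReg d))))))))

end ArrExpr

namespace ArrStmt

def compile : ArrStmt → ℕ → RAMProgram
  | skip, _ => .skip
  | set x a, d => .seq (a.compile d) (.seq (.const (varReg x) 0)
      (.add (varReg x) (varReg x) (tempReg d)))
  | put k a b, d => .seq (b.compile d) (.seq (a.compile (d + 1))
      (.seq (.add (tempReg (d + 1)) (tempReg (d + 1)) (tempReg (d + 1)))
      (.seq (.add (tempReg (d + 1)) (tempReg (d + 1)) (tempReg (d + 1)))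
      (.seq (.add (tempReg (d + 1)) (tempReg (d + 1)) (tempReg (d + 1)))
      (.seq (.const (tempReg (d + 2)) k)
      (.seq (.add (tempReg (d + 1)) (tempReg (d + 1)) (tempReg (d + 2)))
      (.seq (.add (tempReg (d + 1)) (tempReg (d + 1)) 2)
      (.store (tempReg (d + 1)) (tempReg d)))))))))
  | out a b, d => .seq (b.compile d) (.seq (a.compile (d + 1))
      (.seq (.sub (tempReg (d + 2)) 2 (tempReg (d + 1)))
      (.branch (tempReg (d + 2)) (.store (tempReg (d + 1)) (tempReg d)) .skip)))
  | seq P Q, d => .seq (P.compile d) (Q.compile d)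
  | ite a P Q, d => .seq (a.compile d) (.branch (tempReg d) (P.compile d) (Q.compile d))
  | .loop x P, d => .seq (.const (tempReg d) 0) (.seq (.add (tempReg d) (tempReg d) 0)
      (.loop (tempReg d) (.seq (.const (varReg x) 0) (.seq (.add (varReg x) (varReg x) 0)
        (.seq (.sub (varReg x) (varReg x) (tempReg d)) (.seq (P.compile (d + 1))
        (.seq (.const (tempReg (d + 1)) 1)
        (.sub (tempReg d) (tempReg d) (tempReg (d + 1))))))))))

end ArrStmt

/-! ### Correctness of the compiler -/

/-- A machine state represents a state of array programs: `size` is in register `0`, `base` in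
register `2`, and the entry `i` of the array `k` in the memory cell `base + 8 * i + k`. -/
structure ArrEnv.RepresentedBy (e : ArrEnv) (s : RAMState) : Prop where
  size : s.reg 0 = e.size
  base : s.reg 2 = e.base
  var : ∀ x, s.reg (varReg x) = e.var x
  inp : ∀ a, a < e.base → s.mem a = e.inp a
  arr : ∀ (k : Fin 8) (i : ℕ), s.mem (e.base + (8 * i + k)) = e.arr k i

/-- Two machine states agree up to the temporary registers from `d` on. -/
structure RAMState.AgreeBelow (d : ℕ) (s u : RAMState) : Prop where
  mem : u.mem = s.mem
  reg : ∀ r, (∀ d', d ≤ d' → r ≠ tempReg d') → u.reg r = s.reg r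

theorem RAMState.AgreeBelow.represented {d : ℕ} {s u : RAMState} (h : s.AgreeBelow d u)
    {e : ArrEnv} (he : e.RepresentedBy s) : e.RepresentedBy u where
  size := by rw [h.reg _ (fun d' _ => by unfold tempReg; omega), he.size]
  base := by rw [h.reg _ (fun d' _ => by unfold tempReg; omega), he.base]
  var x := by rw [h.reg _ (fun d' _ => by unfold tempReg varReg; omega), he.var]
  inp a ha := by rw [h.mem, he.inp a ha]
  arr k i := by rw [h.mem, he.arr]

theorem RAMState.AgreeBelow.trans {d d' : ℕ} {s u v : RAMState} (h : s.AgreeBelow d u)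
    (h' : u.AgreeBelow d' v) (hd : d ≤ d') : s.AgreeBelow d v where
  mem := h'.mem.trans h.mem
  reg r hr := (h'.reg r fun c hc => hr c (hd.trans hc)).trans (h.reg r hr)

theorem RAMState.AgreeBelow.setTemp {d d' v : ℕ} {s u : RAMState} (h : s.AgreeBelow d u)
    (hd : d ≤ d') : s.AgreeBelow d (u.setReg (tempReg d') v) where
  mem := h.mem
  reg r hr := by
    simp [RAMState.setReg, hr d' hd, h.reg r hr]

theorem RAMState.AgreeBelow.refl (d : ℕ) (s : RAMState) : s.AgreeBelow d s :=
  ⟨rfl, fun _ _ => rfl⟩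

theorem RAMState.AgreeBelow.temp {d d' : ℕ} {s u : RAMState} (h : s.AgreeBelow d u)
    (hd : d' < d) : u.reg (tempReg d') = s.reg (tempReg d') :=
  h.reg _ fun c hc => by unfold tempReg; omega

-- Temporary registers are odd; variables occupy the even registers from `4` on, which leaves `0`
-- and `2` for `size` and `base`. The three kinds never collide.
@[simp] theorem tempReg_inj {a b : ℕ} : tempReg a = tempReg b ↔ a = b := by
  unfold tempReg; omega
@[simp] theorem varReg_inj {a b : ℕ} : varReg a = varReg b ↔ a = b := by
  unfold varReg; omega
@[simp] theorem tempReg_ne_varReg {a b : ℕ} : tempReg a ≠ varReg b := by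
  unfold tempReg varReg; omega
@[simp] theorem varReg_ne_tempReg {a b : ℕ} : varReg a ≠ tempReg b := tempReg_ne_varReg.symm
@[simp] theorem zero_ne_varReg {a : ℕ} : 0 ≠ varReg a := by unfold varReg; omega
@[simp] theorem two_ne_varReg {a : ℕ} : 2 ≠ varReg a := by unfold varReg; omega
@[simp] theorem zero_ne_tempReg {a : ℕ} : 0 ≠ tempReg a := by unfold tempReg; omega
@[simp] theorem two_ne_tempReg {a : ℕ} : 2 ≠ tempReg a := by unfold tempReg; omega

@[simp] theorem RAMState.setReg_reg (s : RAMState) (x v y : ℕ) :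
    (s.setReg x v).reg y = if y = x then v else s.reg y := by
  simp [RAMState.setReg, Function.update_apply]
@[simp] theorem RAMState.setReg_mem (s : RAMState) (x v : ℕ) : (s.setReg x v).mem = s.mem := rfl
@[simp] theorem RAMState.setMem_mem (s : RAMState) (x v y : ℕ) :
    (s.setMem x v).mem y = if y = x then v else s.mem y := by
  simp [RAMState.setMem, Function.update_apply]
@[simp] theorem RAMState.setMem_reg (s : RAMState) (x v : ℕ) : (s.setMem x v).reg = s.reg := rfl

/-- A loop that adds `y` to `x` as often as the counter `c` says. -/
theorem RAMExec.mul_loop {x y c o : ℕ} (hxy : x ≠ y) (hxc : x ≠ c) (hxo : x ≠ o) (hyc : y ≠ c)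
    (hco : c ≠ o) (n : ℕ) (s : RAMState) (hn : s.reg c = n) (ho : s.reg o = 1) :
    ∃ u, RAMExec (.loop c (.seq (.add x x y) (.sub c c o))) s u (3 * n + 1) ∧
      u.mem = s.mem ∧ u.reg x = s.reg x + s.reg y * n ∧ ∀ r, r ≠ x → r ≠ c → u.reg r = s.reg r := by
  induction n generalizing s with
  | zero => exact ⟨s, .loop_false hn, rfl, by simp, fun _ _ _ => rfl⟩
  | succ n ih =>
    let s' := (s.setReg x (s.reg x + s.reg y)).setReg c (n + 1 - 1)
    obtain ⟨u, hu, hm, hx, hr⟩ := ih s' (by simp [s']) (by simp [s', hco.symm, hxo.symm, ho])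
    refine ⟨u, ?_, ?_, ?_, ?_⟩
    · have h1 : RAMExec (.seq (.add x x y) (.sub c c o)) s s' (1 + 1) := by
        refine .seq (.add x x y s) ?_
        have := RAMExec.sub c c o (s.setReg x (s.reg x + s.reg y))
        simpa [s', hxc.symm, hxo.symm, ho, hn] using this
      have := RAMExec.loop_true (by omega) h1 hu
      convert this using 1
      ring
    · rw [hm]; rfl
    · rw [hx]; simp [s', hxc, hxy.symm, hyc]; ring
    · intro r h1 h2
      rw [hr r h1 h2]; simp [s', h1, h2]

/-- Temporaries are used as a stack: the second operand is evaluated at depth `d + 1` and so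
preserves the first one, held at depth `d`. Memory is never written, so the represented state
persists. -/
theorem ArrExpr.exec_compile (a : ArrExpr) {e : ArrEnv} (d : ℕ) (s : RAMState)
    (hs : e.RepresentedBy s) :
    ∃ u τ, RAMExec (a.compile d) s u τ ∧ τ ≤ a.cost e.size ∧ u.reg (tempReg d) = a.eval e ∧
      s.AgreeBelow d u := by
  induction a generalizing d s with
  | lit c => exact ⟨_, _, .const _ _ _, le_rfl, by simp [eval], (RAMState.AgreeBelow.refl d s).setTemp le_rfl⟩
  | size =>
    exact ⟨_, _, .seq (.const _ _ _) (.add _ _ _ _), le_rfl, by simp [eval, hs.size],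
      ((RAMState.AgreeBelow.refl d s).setTemp le_rfl).setTemp le_rfl⟩
  | var x =>
    exact ⟨_, _, .seq (.const _ _ _) (.add _ _ _ _), le_rfl, by simp [eval, hs.var],
      ((RAMState.AgreeBelow.refl d s).setTemp le_rfl).setTemp le_rfl⟩
  | add a b iha ihb =>
    obtain ⟨u, τ, h1, h2, h3, h4⟩ := iha d s hs
    obtain ⟨v, σ, k1, k2, k3, k4⟩ := ihb (d + 1) u (h4.represented hs)
    refine ⟨_, _, .seq h1 (.seq k1 (.add _ _ _ _)), ?_, ?_, (h4.trans k4 (by omega)).setTemp le_rfl⟩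
    · simp only [cost]; omega
    · simp [eval, k3, k4.temp (Nat.lt_succ_self d), h3]
  | sub a b iha ihb =>
    obtain ⟨u, τ, h1, h2, h3, h4⟩ := iha d s hs
    obtain ⟨v, σ, k1, k2, k3, k4⟩ := ihb (d + 1) u (h4.represented hs)
    refine ⟨_, _, .seq h1 (.seq k1 (.sub _ _ _ _)), ?_, ?_, (h4.trans k4 (by omega)).setTemp le_rfl⟩
    · simp only [cost]; omega
    · simp [eval, k3, k4.temp (Nat.lt_succ_self d), h3]
  | scale a iha =>
    obtain ⟨u, τ, h1, h2, h3, h4⟩ := iha (d + 1) s hs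
    have hu := h4.represented hs
    obtain ⟨v, k1, k2, k3, k4⟩ := RAMExec.mul_loop (x := tempReg d) (y := tempReg (d + 1))
      (c := tempReg (d + 3)) (o := tempReg (d + 2)) (by simp) (by simp) (by simp) (by simp)
      (by simp) e.size ((((u.setReg (tempReg d) 0).setReg (tempReg (d + 2)) 1).setReg
        (tempReg (d + 3)) 0).setReg (tempReg (d + 3)) (0 + u.reg 0)) (by simp [hu.size]) (by simp)
    refine ⟨v, τ + (1 + (1 + (1 + (1 + (3 * e.size + 1))))), .seq h1 (.seq (.const _ _ _)
      (.seq (.const _ _ _) (.seq (.const _ _ _) (.seq (.add _ _ _ _) ?_)))), ?_, ?_, ?_⟩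
    · simpa using k1
    · simp only [cost]; omega
    · rw [k3]; simp [eval, h3]
    · have h5 : s.AgreeBelow d u := (RAMState.AgreeBelow.refl d s).trans h4 (by omega)
      refine ⟨k2.trans h5.mem, fun r hr => ?_⟩
      have e0 := hr d (by omega)
      have e2 := hr (d + 2) (by omega)
      have e3 := hr (d + 3) (by omega)
      rw [k4 r e0 e3]
      simp [e0, e2, e3, h5.reg r hr]
  | inp a iha =>
    obtain ⟨u, τ, h1, h2, h3, h4⟩ := iha d s hs
    have hu := h4.represented hs
    by_cases hb : a.eval e < e.base
    · refine ⟨_, _, .seq h1 (.seq (.sub _ _ _ _) (.branch_true ?_ (.load _ _ _))), ?_, ?_,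
        (h4.setTemp (by omega)).setTemp (by omega)⟩
      · simp [h3, hu.base]; omega
      · simp only [cost]; omega
      · simp [eval, h3, hb, hu.inp]
    · refine ⟨_, _, .seq h1 (.seq (.sub _ _ _ _) (.branch_false ?_ (.const _ _ _))), ?_, ?_,
        (h4.setTemp (by omega)).setTemp (by omega)⟩
      · simp [h3, hu.base]; omega
      · simp only [cost]; omega
      · simp [eval, hb]
  | get k a iha =>
    obtain ⟨u, τ, h1, h2, h3, h4⟩ := iha d s hs
    have hu := h4.represented hs
    -- Three doublings produce `8 * i`, since the eight arrays are interleaved above `base`.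
    refine ⟨_, _, .seq h1 (.seq (.add _ _ _ _) (.seq (.add _ _ _ _) (.seq (.add _ _ _ _)
      (.seq (.const _ _ _) (.seq (.add _ _ _ _) (.seq (.add _ _ _ _) (.load _ _ _))))))), ?_, ?_, ?_⟩
    · simp only [cost]; omega
    · simp [eval, h3, hu.base, ← hu.arr]
      congr 1; omega
    · repeat refine RAMState.AgreeBelow.setTemp ?_ (by omega)
      exact h4

/-- Two machine states agree on the temporary registers below `d`. -/
def RAMState.TempsEq (d : ℕ) (s u : RAMState) : Prop :=
  ∀ d' < d, u.reg (tempReg d') = s.reg (tempReg d')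

theorem RAMState.AgreeBelow.tempsEq {d : ℕ} {s u : RAMState} (h : s.AgreeBelow d u) :
    s.TempsEq d u := fun _ hd => h.temp hd

theorem ArrEnv.RepresentedBy.setVar {e : ArrEnv} {s : RAMState} (hs : e.RepresentedBy s)
    (x v : ℕ) : (e.setVar x v).RepresentedBy (s.setReg (varReg x) v) where
  size := by simp [hs.size, ArrEnv.setVar]
  base := by simp [hs.base, ArrEnv.setVar]
  var y := by simp [hs.var, ArrEnv.setVar, Function.update_apply]
  inp a ha := hs.inp a ha
  arr k i := hs.arr k i

theorem ArrEnv.RepresentedBy.setTemp {e : ArrEnv} {s : RAMState} (hs : e.RepresentedBy s)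
    (x v : ℕ) : e.RepresentedBy (s.setReg (tempReg x) v) :=
  ((RAMState.AgreeBelow.refl x s).setTemp le_rfl).represented hs

theorem ArrEnv.RepresentedBy.setArr {e : ArrEnv} {s : RAMState} (hs : e.RepresentedBy s)
    (k : Fin 8) (i v : ℕ) : (e.setArr k i v).RepresentedBy (s.setMem (e.base + (8 * i + k)) v) where
  size := hs.size
  base := hs.base
  var := hs.var
  inp a ha := by
    have h : a < e.base := ha
    simp only [RAMState.setMem_mem, ArrEnv.setArr]
    rw [if_neg (by omega), hs.inp a ha]
  arr k' i' := by
    simp only [RAMState.setMem_mem, ArrEnv.setArr, Function.update_apply]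
    by_cases hk : k' = k
    · subst hk
      by_cases hi : i' = i
      · simp [hi]
      · rw [if_neg (by omega)]; simp [hi, hs.arr]
    · have : (k' : ℕ) ≠ k := fun h => hk (Fin.ext h)
      rw [if_neg (by omega)]; simp [hk, hs.arr]

theorem ArrEnv.RepresentedBy.setInp {e : ArrEnv} {s : RAMState} (hs : e.RepresentedBy s)
    {i : ℕ} (hi : i < e.base) (v : ℕ) : (e.setInp i v).RepresentedBy (s.setMem i v) := by
  rw [ArrEnv.setInp, if_pos hi]
  refine ⟨hs.size, hs.base, hs.var, fun a ha => ?_, fun k j => ?_⟩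
  · simp only [RAMState.setMem_mem, Function.update_apply, hs.inp a ha]
  · simp only [RAMState.setMem_mem]
    rw [if_neg (by omega), hs.arr]

@[simp] theorem ArrEnv.setVar_size (e : ArrEnv) (x v : ℕ) : (e.setVar x v).size = e.size := rfl
@[simp] theorem ArrEnv.setArr_size (e : ArrEnv) (k : Fin 8) (i v : ℕ) :
    (e.setArr k i v).size = e.size := rfl
@[simp] theorem ArrEnv.setInp_size (e : ArrEnv) (i v : ℕ) : (e.setInp i v).size = e.size := by
  unfold ArrEnv.setInp; split <;> rfl
@[simp] theorem ArrEnv.setVar_base (e : ArrEnv) (x v : ℕ) : (e.setVar x v).base = e.base := rfl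
@[simp] theorem ArrEnv.setArr_base (e : ArrEnv) (k : Fin 8) (i v : ℕ) :
    (e.setArr k i v).base = e.base := rfl
@[simp] theorem ArrEnv.setInp_base (e : ArrEnv) (i v : ℕ) : (e.setInp i v).base = e.base := by
  unfold ArrEnv.setInp; split <;> rfl

theorem forIter_invariant {α : Type} {f : ℕ → α → α} {n : ℕ} {e : α} (I : ℕ → α → Prop)
    (h0 : I 0 e) (hs : ∀ i < n, ∀ u, I i u → I (i + 1) (f i u)) : I n (forIter f n e) := by
  have : ∀ i ≤ n, I i (forIter f i e) := by
    intro i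
    induction i with
    | zero => exact fun _ => h0
    | succ i ih => exact fun hi => hs i hi _ (ih (by omega))
  exact this n le_rfl

@[simp] theorem ArrStmt.run_size (P : ArrStmt) (e : ArrEnv) : (P.run e).size = e.size := by
  induction P generalizing e with
  | skip | set | put | out => simp [run]
  | seq P Q hP hQ => simp [run, hP, hQ]
  | ite a P Q hP hQ => simp only [run]; split <;> simp [hP, hQ]
  | loop x P hP =>
    exact forIter_invariant (fun _ (u : ArrEnv) => u.size = e.size) rfl fun i _ u hu => by simp [hP, hu]

@[simp] theorem ArrStmt.run_base (P : ArrStmt) (e : ArrEnv) : (P.run e).base = e.base := by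
  induction P generalizing e with
  | skip | set | put | out => simp [run]
  | seq P Q hP hQ => simp [run, hP, hQ]
  | ite a P Q hP hQ => simp only [run]; split <;> simp [hP, hQ]
  | loop x P hP =>
    exact forIter_invariant (fun _ (u : ArrEnv) => u.base = e.base) rfl fun i _ u hu => by simp [hP, hu]

/-- Statements change variables and memory, so only the temporaries below `d` are claimed to
survive. This is what protects the counters of the enclosing loops. -/
theorem ArrStmt.exec_compile (P : ArrStmt) (e : ArrEnv) (d : ℕ) (s : RAMState)
    (hs : e.RepresentedBy s) :
    ∃ u τ, RAMExec (P.compile d) s u τ ∧ τ ≤ P.cost e.size ∧ (P.run e).RepresentedBy u ∧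
      s.TempsEq d u := by
  induction P generalizing d s e with
  | skip => exact ⟨s, 1, .skip s, le_rfl, hs, fun _ _ => rfl⟩
  | set x a =>
    obtain ⟨u, τ, h1, h2, h3, h4⟩ := a.exec_compile d s hs
    refine ⟨_, _, .seq h1 (.seq (.const _ _ _) (.add _ _ _ _)), ?_, ?_, ?_⟩
    · simp only [cost]; omega
    · have := (h4.represented hs).setVar x (a.eval e)
      refine ⟨by simpa using this.size, this.base, fun y => ?_,
        this.inp, this.arr⟩
      have h := this.var y
      by_cases hy : y = x <;> simp [hy, h3, run] at h ⊢ <;> simpa using h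
    · intro d' hd; simpa using h4.temp hd
  | put k a b =>
    obtain ⟨u, τ, h1, h2, h3, h4⟩ := b.exec_compile d s hs
    obtain ⟨v, σ, k1, k2, k3, k4⟩ := a.exec_compile (d + 1) u (h4.represented hs)
    have hv := k4.represented (h4.represented hs)
    refine ⟨_, _, .seq h1 (.seq k1 (.seq (.add _ _ _ _) (.seq (.add _ _ _ _)
      (.seq (.add _ _ _ _) (.seq (.const _ _ _) (.seq (.add _ _ _ _) (.seq (.add _ _ _ _)
        (.store _ _ _)))))))), ?_, ?_, ?_⟩
    · simp only [cost]; omega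
    · simp only [run]
      have e1 : v.reg (tempReg d) = b.eval e := by rw [k4.temp (by omega), h3]
      have := (((((((hv.setTemp (d+1) (v.reg (tempReg (d+1)) + v.reg (tempReg (d+1))))).setTemp
        (d + 1) (2 * v.reg (tempReg (d+1)) + 2 * v.reg (tempReg (d+1)))).setTemp (d + 1)
        (4 * v.reg (tempReg (d+1)) + 4 * v.reg (tempReg (d+1)))).setTemp (d + 2) k).setTemp (d + 1)
        (8 * v.reg (tempReg (d+1)) + k)).setTemp (d+1) (8 * v.reg (tempReg (d+1)) + k + e.base)).setArr k
        (a.eval e) (b.eval e)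
      convert this using 1
      simp [k3, e1, hv.base]
      ring_nf
    · intro d' hd
      have e1 : d' ≠ d + 1 := by omega
      have e2 : d' ≠ d + 2 := by omega
      simp [e1, e2, k4.temp (show d' < d + 1 by omega), h4.temp hd]
  | out a b =>
    obtain ⟨u, τ, h1, h2, h3, h4⟩ := b.exec_compile d s hs
    obtain ⟨v, σ, k1, k2, k3, k4⟩ := a.exec_compile (d + 1) u (h4.represented hs)
    have hv := k4.represented (h4.represented hs)
    have ht : ∀ w d', d' < d → (v.setReg (tempReg (d + 2)) w).reg (tempReg d') =
        s.reg (tempReg d') := by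
      intro w d' hd
      have e2 : d' ≠ d + 2 := by omega
      simp [e2, k4.temp (show d' < d + 1 by omega), h4.temp hd]
    by_cases hb : a.eval e < e.base
    · refine ⟨_, _, .seq h1 (.seq k1 (.seq (.sub _ _ _ _) (.branch_true ?_ (.store _ _ _)))),
        ?_, ?_, ?_⟩
      · simp [hv.base, k3]; omega
      · simp only [cost]; omega
      · have := (hv.setTemp (d + 2) (v.reg 2 - v.reg (tempReg (d + 1)))).setInp hb (b.eval e)
        have e1 : v.reg (tempReg d) = b.eval e := by rw [k4.temp (by omega), h3]
        simpa [k3, e1, run] using this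
      · exact ht _
    · refine ⟨_, _, .seq h1 (.seq k1 (.seq (.sub _ _ _ _) (.branch_false ?_ (.skip _)))),
        ?_, ?_, ?_⟩
      · simp [hv.base, k3]; omega
      · simp only [cost]; omega
      · simp only [run, ArrEnv.setInp, if_neg hb]
        exact hv.setTemp _ _
      · exact ht _
  | seq P Q hP hQ =>
    obtain ⟨u, τ, h1, h2, h3, h4⟩ := hP e d s hs
    obtain ⟨v, σ, k1, k2, k3, k4⟩ := hQ _ d u h3
    refine ⟨v, _, .seq h1 k1, ?_, k3, fun d' hd => (k4 d' hd).trans (h4 d' hd)⟩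
    simp only [cost]
    rw [run_size] at k2
    omega
  | ite a P Q hP hQ =>
    obtain ⟨u, τ, h1, h2, h3, h4⟩ := a.exec_compile d s hs
    by_cases ha : a.eval e ≠ 0
    · obtain ⟨v, σ, k1, k2, k3, k4⟩ := hP e d u (h4.represented hs)
      refine ⟨v, _, .seq h1 (.branch_true (by rwa [h3]) k1), ?_, ?_, fun d' hd =>
        (k4 d' hd).trans (h4.tempsEq d' hd)⟩
      · simp only [cost]; omega
      · simpa only [run, if_pos ha] using k3
    · obtain ⟨v, σ, k1, k2, k3, k4⟩ := hQ e d u (h4.represented hs)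
      refine ⟨v, _, .seq h1 (.branch_false (by rw [h3]; simpa using ha) k1), ?_, ?_, fun d' hd =>
        (k4 d' hd).trans (h4.tempsEq d' hd)⟩
      · simp only [cost]; omega
      · simpa only [run, if_neg ha] using k3
  | loop x P hP =>
    set f : ℕ → ArrEnv → ArrEnv := fun i u => P.run (u.setVar x i) with hf
    have hsize : ∀ j, (forIter f j e).size = e.size := fun j =>
      forIter_invariant (fun _ (u : ArrEnv) => u.size = e.size) rfl fun i _ u hu => by simp [hf, hu]
    -- The machine counter `c` runs down to zero while the loop variable `j = size - c` runs up; the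
    -- induction is on the remaining iterations.
    have key : ∀ c j s', c + j = e.size → s'.reg (tempReg d) = c →
        (forIter f j e).RepresentedBy s' → ∃ u τ,
        RAMExec (.loop (tempReg d) (.seq (.const (varReg x) 0) (.seq (.add (varReg x) (varReg x) 0)
        (.seq (.sub (varReg x) (varReg x) (tempReg d)) (.seq (P.compile (d + 1))
        (.seq (.const (tempReg (d + 1)) 1)
        (.sub (tempReg d) (tempReg d) (tempReg (d + 1))))))))) s' u τ ∧
        τ ≤ 1 + c * (P.cost e.size + 7) ∧ (forIter f e.size e).RepresentedBy u ∧
        s'.TempsEq d u := by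
      intro c
      induction c with
      | zero =>
        intro j s' hj hc hr
        obtain rfl : j = e.size := by omega
        exact ⟨s', _, .loop_false hc, by omega, hr, fun _ _ => rfl⟩
      | succ c ih =>
        intro j s' hj hc hr
        have hr' : ((forIter f j e).setVar x j).RepresentedBy
            (((s'.setReg (varReg x) 0).setReg (varReg x) (0 + s'.reg 0)).setReg (varReg x)
              (0 + s'.reg 0 - s'.reg (tempReg d))) := by
          have := hr.setVar x j
          have h0 : 0 + s'.reg 0 - s'.reg (tempReg d) = j := by
            rw [hr.size, hsize, hc]; omega
          rw [h0]
          refine ⟨by simpa using this.size, this.base, fun y => ?_,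
            this.inp, this.arr⟩
          have h := this.var y
          by_cases hy : y = x <;> simp [hy] at h ⊢ <;> simpa using h
        obtain ⟨v, σ, k1, k2, k3, k4⟩ := hP _ (d + 1) _ hr'
        obtain ⟨w, ρ, l1, l2, l3, l4⟩ := ih (j + 1)
          ((v.setReg (tempReg (d + 1)) 1).setReg (tempReg d) c) (by omega) (by simp)
          ((k3.setTemp _ _).setTemp _ _)
        have hvc : v.reg (tempReg d) = c + 1 := by
          rw [k4 d (by omega)]; simp [hc]
        refine ⟨w, _, .loop_true (u := (v.setReg (tempReg (d + 1)) 1).setReg (tempReg d) c)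
          (by omega) (.seq (.const _ _ _) (.seq (.add _ _ _ _)
          (.seq (.sub _ _ _ _) (.seq (u := v) (τ := σ) ?_ (.seq (.const _ _ _) (σ := 1) ?_))))) l1,
          ?_, l3, ?_⟩
        · simpa using k1
        · have := RAMExec.sub (tempReg d) (tempReg d) (tempReg (d + 1))
            (v.setReg (tempReg (d + 1)) 1)
          simpa [hvc] using this
        · rw [ArrEnv.setVar_size, hsize] at k2
          have : (c + 1) * (P.cost e.size + 7) = c * (P.cost e.size + 7) + (P.cost e.size + 7) := by
            ring
          omega
        · intro d' hd
          have e1 : d' ≠ d := by omega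
          have e2 : d' ≠ d + 1 := by omega
          rw [l4 d' hd]
          simp only [RAMState.setReg_reg, tempReg_inj, e1, e2, if_false]
          rw [k4 d' (by omega)]
          simp
    obtain ⟨u, τ, h1, h2, h3, h4⟩ := key e.size 0
      ((s.setReg (tempReg d) 0).setReg (tempReg d) (0 + s.reg 0)) (by omega)
      (by simp [hs.size]) ((hs.setTemp _ _).setTemp _ _)
    refine ⟨u, _, .seq (.const _ _ _) (.seq (.add _ _ _ _) (τ := 1) (σ := τ) ?_), ?_, h3, ?_⟩
    · simpa using h1
    · simp only [cost]; omega
    · intro d' hd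
      have e1 : d' ≠ d := by omega
      rw [h4 d' hd]; simp [e1]

/-! ### Polynomial running time -/

theorem ArrExpr.exists_cost_le (a : ArrExpr) : ∃ C, ∀ M, a.cost M ≤ C * (M + 1) := by
  induction a with
  | lit | size | var => exact ⟨2, fun M => by simp only [cost]; omega⟩
  | add a b ha hb | sub a b ha hb =>
    obtain ⟨C, hC⟩ := ha
    obtain ⟨D, hD⟩ := hb
    refine ⟨C + D + 1, fun M => ?_⟩
    have := hC M
    have := hD M
    simp only [cost, add_mul]; omega
  | scale a ha | inp a ha | get k a ha =>
    obtain ⟨C, hC⟩ := ha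
    refine ⟨C + 7, fun M => ?_⟩
    have := hC M
    simp only [cost, add_mul]; omega

/-- Each nested loop raises the exponent by one, because every loop runs exactly `size` times. -/
theorem ArrStmt.exists_cost_le (P : ArrStmt) : ∃ C D, ∀ M, P.cost M ≤ C * (M + 1) ^ D := by
  have hexpr : ∀ a : ArrExpr, ∃ C, ∀ D M, a.cost M ≤ C * (M + 1) ^ (D + 1) := fun a => by
    obtain ⟨C, hC⟩ := a.exists_cost_le
    refine ⟨C, fun D M => (hC M).trans (Nat.mul_le_mul_left _ ?_)⟩
    exact Nat.le_self_pow (by omega) _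
  have hone : ∀ c D M, c ≤ c * (M + 1) ^ D := fun c D M => Nat.le_mul_of_pos_right _ (by positivity)
  have hmono : ∀ C D D' M, D ≤ D' → C * (M + 1) ^ D ≤ C * (M + 1) ^ D' := fun C D D' M h =>
    Nat.mul_le_mul_left _ (Nat.pow_le_pow_right (by omega) h)
  induction P with
  | skip => exact ⟨1, 0, fun M => by simp [cost]⟩
  | set x a =>
    obtain ⟨C, hC⟩ := hexpr a
    refine ⟨C + 2, 1, fun M => ?_⟩
    have := hC 0 M
    rw [zero_add] at this
    have := hone 2 1 M
    simp only [cost, add_mul]; omega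
  | put k a b | out a b =>
    obtain ⟨C, hC⟩ := hexpr a
    obtain ⟨C', hC'⟩ := hexpr b
    refine ⟨C + C' + 7, 1, fun M => ?_⟩
    have h1 := hC 0 M
    have h2 := hC' 0 M
    rw [zero_add] at h1 h2
    have := hone 7 1 M
    simp only [cost, add_mul]; omega
  | seq P Q hP hQ =>
    obtain ⟨C, D, h⟩ := hP
    obtain ⟨C', D', h'⟩ := hQ
    refine ⟨C + C', D + D', fun M => ?_⟩
    have := (h M).trans (hmono C D (D + D') M (by omega))
    have := (h' M).trans (hmono C' D' (D + D') M (by omega))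
    simp only [cost, add_mul]; omega
  | ite a P Q hP hQ =>
    obtain ⟨C, D, h⟩ := hP
    obtain ⟨C', D', h'⟩ := hQ
    obtain ⟨C₀, h₀⟩ := hexpr a
    refine ⟨C₀ + C + C' + 1, D + D' + 1, fun M => ?_⟩
    have := (h M).trans (hmono C D (D + D' + 1) M (by omega))
    have := (h' M).trans (hmono C' D' (D + D' + 1) M (by omega))
    have := h₀ (D + D') M
    have := hone 1 (D + D' + 1) M
    simp only [cost, add_mul]; omega
  | loop x P hP =>
    obtain ⟨C, D, h⟩ := hP
    refine ⟨C + 10, D + 1, fun M => ?_⟩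
    have h1 := h M
    have h2 := hone 7 D M
    have h3 := hone 3 (D + 1) M
    simp only [cost]
    calc 3 + M * (P.cost M + 7) ≤ 3 * (M + 1) ^ (D + 1) +
          (M + 1) * (C * (M + 1) ^ D + 7 * (M + 1) ^ D) :=
          add_le_add h3 (Nat.mul_le_mul (by omega) (by omega))
      _ = (C + 10) * (M + 1) ^ (D + 1) := by ring

/-! ### Frames -/

namespace ArrStmt

/-- The variables that a statement may modify. -/
def vars : ArrStmt → List ℕ
  | skip | put _ _ _ | out _ _ => []
  | set x _ => [x]
  | seq P Q => P.vars ++ Q.vars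
  | ite _ P Q => P.vars ++ Q.vars
  | .loop x P => x :: P.vars

/-- The arrays that a statement may modify. -/
def arrs : ArrStmt → List (Fin 8)
  | skip | set _ _ | out _ _ => []
  | put k _ _ => [k]
  | seq P Q => P.arrs ++ Q.arrs
  | ite _ P Q => P.arrs ++ Q.arrs
  | .loop _ P => P.arrs

/-- The statement does not write to the input memory. -/
def noOut : ArrStmt → Bool
  | skip | set _ _ | put _ _ _ => true
  | out _ _ => false
  | seq P Q => P.noOut && Q.noOut
  | ite _ P Q => P.noOut && Q.noOut
  | .loop _ P => P.noOut

end ArrStmt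

/-- Two states agree except for some variables and arrays. -/
structure ArrEnv.Frame (X : List ℕ) (K : List (Fin 8)) (e u : ArrEnv) : Prop where
  size : u.size = e.size
  base : u.base = e.base
  inp : u.inp = e.inp
  var : ∀ x ∉ X, u.var x = e.var x
  arr : ∀ k ∉ K, u.arr k = e.arr k

namespace ArrEnv.Frame

theorem refl (X : List ℕ) (K : List (Fin 8)) (e : ArrEnv) : Frame X K e e :=
  ⟨rfl, rfl, rfl, fun _ _ => rfl, fun _ _ => rfl⟩

theorem trans {X Y Z : List ℕ} {K L N : List (Fin 8)} {e u v : ArrEnv} (h : Frame X K e u)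
    (h' : Frame Y L u v) (hX : X ⊆ Z) (hY : Y ⊆ Z) (hK : K ⊆ N) (hL : L ⊆ N) :
    Frame Z N e v where
  size := h'.size.trans h.size
  base := h'.base.trans h.base
  inp := h'.inp.trans h.inp
  var x hx := (h'.var x fun hc => hx (hY hc)).trans (h.var x fun hc => hx (hX hc))
  arr k hk := (h'.arr k fun hc => hk (hL hc)).trans (h.arr k fun hc => hk (hK hc))

theorem mono {X Z : List ℕ} {K N : List (Fin 8)} {e u : ArrEnv} (h : Frame X K e u)
    (hX : X ⊆ Z) (hK : K ⊆ N) : Frame Z N e u :=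
  h.trans (refl Z N u) hX (fun _ => id) hK (fun _ => id)

theorem setVar (e : ArrEnv) (x v : ℕ) : Frame [x] [] e (e.setVar x v) :=
  ⟨rfl, rfl, rfl, fun y hy => by
    have : y ≠ x := by simpa using hy
    simp [ArrEnv.setVar, this], fun _ _ => rfl⟩

theorem setArr (e : ArrEnv) (k : Fin 8) (i v : ℕ) : Frame [] [k] e (e.setArr k i v) :=
  ⟨rfl, rfl, rfl, fun _ _ => rfl, fun y hy => by
    have : y ≠ k := by simpa using hy
    simp [ArrEnv.setArr, this]⟩

end ArrEnv.Frame

/-- The syntactic lists of modified variables and arrays make most preservation facts decidable. The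
absence of output keeps the field tables and the received word intact. -/
theorem ArrStmt.run_frame (P : ArrStmt) (hP : P.noOut) (e : ArrEnv) :
    e.Frame P.vars P.arrs (P.run e) := by
  induction P generalizing e with
  | skip => exact .refl _ _ _
  | set x a => exact .setVar _ _ _
  | put k a b => exact .setArr _ _ _ _
  | out a b => simp [noOut] at hP
  | seq P Q ihP ihQ =>
    simp only [noOut, Bool.and_eq_true] at hP
    exact (ihP hP.1 e).trans (ihQ hP.2 _) (by simp [vars]) (by simp [vars]) (by simp [arrs])
      (by simp [arrs])
  | ite a P Q ihP ihQ =>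
    simp only [noOut, Bool.and_eq_true] at hP
    simp only [run]
    split
    · exact (ihP hP.1 e).mono (by simp [vars]) (by simp [arrs])
    · exact (ihQ hP.2 e).mono (by simp [vars]) (by simp [arrs])
  | loop x P ih =>
    simp only [noOut] at hP
    refine forIter_invariant (fun _ u => e.Frame (x :: P.vars) P.arrs u) (.refl _ _ _)
      fun i _ u hu => ?_
    refine hu.trans (((ArrEnv.Frame.setVar u x i).trans (Z := x :: P.vars) (N := P.arrs)
      (ih hP _)) ?_ ?_ ?_ ?_) ?_ ?_ ?_ ?_ <;> simp

/-- The invariant rule for loops. -/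
theorem ArrStmt.run_for {x : ℕ} {P : ArrStmt} (hP : P.noOut) {e : ArrEnv} (I : ℕ → ArrEnv → Prop)
    (h0 : I 0 e) (hs : ∀ i < e.size, ∀ u, e.Frame (x :: P.vars) P.arrs u → I i u →
      I (i + 1) (P.run (u.setVar x i))) :
    I e.size ((ArrStmt.loop x P).run e) := by
  refine (forIter_invariant (fun i u => e.Frame (x :: P.vars) P.arrs u ∧ I i u) ⟨.refl _ _ _, h0⟩
      fun i hi u hu => ⟨?_, hs i hi u hu.1 hu.2⟩).2
  refine hu.1.trans (((ArrEnv.Frame.setVar u x i).trans (Z := x :: P.vars) (N := P.arrs)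
      (P.run_frame hP _)) ?_ ?_ ?_ ?_) ?_ ?_ ?_ ?_ <;> simp

@[simp] theorem ArrEnv.setVar_var (e : ArrEnv) (x v y : ℕ) :
    (e.setVar x v).var y = if y = x then v else e.var y := by
  simp [ArrEnv.setVar, Function.update_apply]
@[simp] theorem ArrEnv.setVar_arr (e : ArrEnv) (x v : ℕ) : (e.setVar x v).arr = e.arr := rfl
@[simp] theorem ArrEnv.setVar_inp (e : ArrEnv) (x v : ℕ) : (e.setVar x v).inp = e.inp := rfl
@[simp] theorem ArrEnv.setArr_var (e : ArrEnv) (k : Fin 8) (i v : ℕ) :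
    (e.setArr k i v).var = e.var := rfl
@[simp] theorem ArrEnv.setArr_inp (e : ArrEnv) (k : Fin 8) (i v : ℕ) :
    (e.setArr k i v).inp = e.inp := rfl
theorem ArrEnv.setArr_arr_self (e : ArrEnv) (k : Fin 8) (i v j : ℕ) :
    (e.setArr k i v).arr k j = if j = i then v else e.arr k j := by
  simp [ArrEnv.setArr, Function.update_apply]

/-! ### Field arithmetic by table lookup -/

namespace ArrExpr

def fadd (a b : ArrExpr) : ArrExpr := .inp (.add (.lit 2) (.add (.scale a) b))

def fmul (a b : ArrExpr) : ArrExpr :=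
  .inp (.add (.add (.lit 2) (.scale .size)) (.add (.scale a) b))

/-- The entry of a square matrix that is stored row by row. -/
def entry (k : Fin 8) (a b : ArrExpr) : ArrExpr := .get k (.add (.scale a) b)

/-- An expression that is nonzero if and only if `a` and `b` differ. -/
def neq (a b : ArrExpr) : ArrExpr := .add (.sub a b) (.sub b a)

theorem eval_neq_ne_zero {a b : ArrExpr} {e : ArrEnv} :
    (neq a b).eval e ≠ 0 ↔ a.eval e ≠ b.eval e := by
  simp only [neq, eval]; omega

end ArrExpr

/-- The tables of the field `F`, with elements numbered by `ν`, are in the input memory. -/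
structure ArrEnv.HasTables {F : Type} [Field F] {q : ℕ} (ν : F ≃ Fin q) (e : ArrEnv) : Prop where
  size : e.size = q
  base : 2 + q * q + q * q ≤ e.base
  add : ∀ x y, e.inp (2 + (ν x * q + ν y)) = ν (x + y)
  mul : ∀ x y, e.inp (2 + q * q + (ν x * q + ν y)) = ν (x * y)

section

variable {F : Type} {q : ℕ} {ν : F ≃ Fin q}

theorem ArrEnv.HasTables.frame [Field F] {e u : ArrEnv} (h : e.HasTables ν) {X : List ℕ}
    {K : List (Fin 8)} (hu : e.Frame X K u) : u.HasTables ν := by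
  refine ⟨hu.size.trans h.size, hu.base ▸ h.base, ?_, ?_⟩ <;> rw [hu.inp]
  exacts [h.add, h.mul]

theorem mul_add_lt_mul_self (i j : Fin q) : (i : ℕ) * q + j < q * q := by
  have h1 := i.2
  have h2 := j.2
  nlinarith

theorem mul_add_inj {i j i' j' : Fin q} :
    (i : ℕ) * q + j = i' * q + j' ↔ i = i' ∧ j = j' := by
  refine ⟨fun h => ?_, fun ⟨h, h'⟩ => by rw [h, h']⟩
  have hq : 0 < q := i.pos
  have h1 : ((i : ℕ) * q + j) / q = i := by
    rw [add_comm, Nat.add_mul_div_right _ _ hq, Nat.div_eq_of_lt j.2, zero_add]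
  have h2 : ((i' : ℕ) * q + j') / q = i' := by
    rw [add_comm, Nat.add_mul_div_right _ _ hq, Nat.div_eq_of_lt j'.2, zero_add]
  have h3 : (i : ℕ) = i' := by rw [← h1, ← h2, h]
  refine ⟨Fin.ext h3, Fin.ext ?_⟩
  rw [h3] at h; omega

theorem ArrExpr.eval_fadd [Field F] {e : ArrEnv} (h : e.HasTables ν) {a b : ArrExpr} {x y : F}
    (ha : a.eval e = ν x) (hb : b.eval e = ν y) : (fadd a b).eval e = ν (x + y) := by
  have := mul_add_lt_mul_self (ν x) (ν y)
  have := h.base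
  simp only [fadd, eval, ha, hb, h.size]
  rw [if_pos (by omega), h.add]

theorem ArrExpr.eval_fmul [Field F] {e : ArrEnv} (h : e.HasTables ν) {a b : ArrExpr} {x y : F}
    (ha : a.eval e = ν x) (hb : b.eval e = ν y) : (fmul a b).eval e = ν (x * y) := by
  have := mul_add_lt_mul_self (ν x) (ν y)
  have := h.base
  simp only [fmul, eval, ha, hb, h.size]
  rw [if_pos (by omega), h.mul]

/-- The array `k` contains the matrix `A`. -/
def ArrEnv.HasMatrix (ν : F ≃ Fin q) (k : Fin 8) (A : Matrix (Fin q) (Fin q) F)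
    (e : ArrEnv) : Prop :=
  ∀ i j : Fin q, e.arr k (i * q + j) = ν (A i j)

theorem ArrEnv.HasMatrix.frame {e u : ArrEnv} {k : Fin 8} {A : Matrix (Fin q) (Fin q) F}
    (h : e.HasMatrix ν k A) {X : List ℕ} {K : List (Fin 8)} (hu : e.Frame X K u) (hk : k ∉ K) :
    u.HasMatrix ν k A := by
  unfold HasMatrix; rw [hu.arr k hk]; exact h

theorem ArrExpr.eval_entry {e : ArrEnv} (hsize : e.size = q) {k : Fin 8}
    {A : Matrix (Fin q) (Fin q) F} (h : e.HasMatrix ν k A) {a b : ArrExpr} {i j : Fin q}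
    (ha : a.eval e = i) (hb : b.eval e = j) : (entry k a b).eval e = ν (A i j) := by
  simp only [entry, eval, ha, hb, hsize, h i j]

/-- Fill the array `k` as a matrix: the entry `(x, y)` is the value of `a` after the
computation `P`. -/
def ArrStmt.fill (k : Fin 8) (x y : ℕ) (P : ArrStmt) (a : ArrExpr) : ArrStmt :=
  .loop x (.loop y (.seq P (.put k (.add (.scale (.var x)) (.var y)) a)))

/-- The loops fill the matrix in lexicographic order, and distinct index pairs have distinct
addresses. The entry must be computed correctly in every state that differs from `e` only in the
array `k` and the scratch variables, so it may depend on the other arrays but not on `k`. -/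
theorem ArrStmt.run_fill {k : Fin 8} {x y : ℕ} {P : ArrStmt} {a : ArrExpr} (hP : P.noOut)
    (hPa : P.arrs = []) (hx : x ∉ P.vars) (hy : y ∉ P.vars) (hxy : x ≠ y) {e : ArrEnv}
    (hsize : e.size = q) (A : Matrix (Fin q) (Fin q) F)
    (h : ∀ (i j : Fin q) (u : ArrEnv), e.Frame (x :: y :: P.vars) [k] u → u.var x = i →
      u.var y = j → a.eval (P.run u) = ν (A i j)) :
    ((fill k x y P a).run e).HasMatrix ν k A := by
  have key : ∀ i : Fin q, ∀ j : Fin q, (i : ℕ) < e.size →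
      ((fill k x y P a).run e).arr k (i * q + j) = ν (A i j) := by
    unfold fill
    refine ArrStmt.run_for (by simp [noOut, hP]) (fun n u => ∀ i : Fin q, ∀ j : Fin q, (i : ℕ) < n →
      u.arr k (i * q + j) = ν (A i j)) (fun i j hi => by omega) fun n hn u hu hI => ?_
    simp only [vars, arrs, hPa, List.append_nil, List.nil_append] at hu
    have hu' : e.Frame (x :: y :: P.vars) [k] (u.setVar x n) :=
      hu.trans (.setVar u x n) (by simp) (by simp) (by simp) (by simp)
    have inner := ArrStmt.run_for (x := y)
      (P := (P.seq (.put k (.add (.scale (.var x)) (.var y)) a))) (by simp [noOut, hP])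
      (e := u.setVar x n) (fun m v => ∀ i : Fin q, ∀ j : Fin q, (i : ℕ) < n ∨ ((i : ℕ) = n ∧
        (j : ℕ) < m) → v.arr k (i * q + j) = ν (A i j))
      (fun i j hij => hI i j (by omega)) ?_
    · intro i j hi
      refine inner i j ?_
      have := j.2
      simp only [ArrEnv.setVar_size, hu.size, hsize]
      omega
    · intro m hm v hv hJ i j hij
      simp only [vars, arrs, hPa, List.append_nil, List.nil_append] at hv
      have hm : m < q := by simpa [hu.size, hsize] using hm
      have hn : n < q := by omega
      have hv' : e.Frame (x :: y :: P.vars) [k] (v.setVar y m) :=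
        (hu'.trans hv (Z := x :: y :: P.vars) (N := [k]) (by simp) (by simp) (by simp)
          (by simp)).trans (.setVar v y m) (by simp) (by simp) (by simp) (by simp)
      have hvx : (v.setVar y m).var x = n := by
        have : x ∉ y :: P.vars := by simp [hxy, hx]
        simp [hxy, hv.var x this]
      have hval := h ⟨n, hn⟩ ⟨m, hm⟩ _ hv' hvx (by simp)
      have hfr := P.run_frame hP (v.setVar y m)
      have h1 : (P.run (v.setVar y m)).var x = n := by rw [hfr.var x hx, hvx]
      have h2 : (P.run (v.setVar y m)).var y = m := by rw [hfr.var y hy]; simp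
      have h3 : (P.run (v.setVar y m)).arr k = v.arr k := by rw [hfr.arr k (by simp [hPa])]; rfl
      have hidx := mul_add_inj (i := i) (j := j) (i' := ⟨n, hn⟩) (j' := ⟨m, hm⟩)
      simp only [run, ArrExpr.eval, h1, h2, hval, run_size, ArrEnv.setVar_size, hv.size, hu.size,
        hsize, ArrEnv.setArr_arr_self, h3]
      simp only at hidx
      split_ifs with hc
      · obtain ⟨rfl, rfl⟩ := hidx.1 hc
        rfl
      · refine hJ i j ?_
        rcases hij with hij | ⟨hi, hj⟩
        · exact Or.inl hij
        · right
          refine ⟨hi, lt_of_le_of_ne (by omega) fun hjm => hc ?_⟩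
          rw [hi, hjm]
  exact fun i j => key i j (by rw [hsize]; exact i.2)

end

/-! ### Computing the rank of a matrix by rank reduction -/

/-- Wedderburn's rank reduction. -/
theorem Matrix.rank_reduction {F : Type} [Field F] {n : Type} [Fintype n] [DecidableEq n]
    (A : Matrix n n F) {r c : n} (h : A r c ≠ 0) :
    (Matrix.of fun i j => A r c * A i j - A i c * A r j).rank + 1 = A.rank := by
  set B : Matrix n n F := Matrix.of fun i j => A r c * A i j - A i c * A r j with hB
  -- Multiplication by `B` is multiplication by `A` after a correction along `e_c`. Hence `ker B =
  -- ker A ⊕ ⟨e_c⟩`: the kernel grows by exactly one dimension, as `(A e_c)_r ≠ 0`.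
  have hBx : ∀ x, B.mulVec x = A.mulVec (A r c • x - (A.mulVec x r) • Pi.single c 1) := by
    intro x
    rw [Matrix.mulVec_sub, Matrix.mulVec_smul, Matrix.mulVec_smul]
    ext i
    simp only [hB, Matrix.mulVec, dotProduct, Matrix.of_apply, Pi.sub_apply, Pi.smul_apply,
      smul_eq_mul, Matrix.mulVec_single_one, sub_mul, Finset.sum_sub_distrib, Matrix.col_apply]
    rw [Finset.mul_sum, Finset.sum_mul]
    congr 1
    · exact Finset.sum_congr rfl fun j _ => by ring
    · exact Finset.sum_congr rfl fun j _ => by ring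
  have hker : LinearMap.ker B.mulVecLin =
      LinearMap.ker A.mulVecLin ⊔ Submodule.span F {Pi.single c (1 : F)} := by
    ext x
    rw [LinearMap.mem_ker, Matrix.mulVecLin_apply, hBx]
    constructor
    · intro hx
      have h1 : A r c • x - (A.mulVec x r) • Pi.single c 1 ∈ LinearMap.ker A.mulVecLin := hx
      have h2 : x = (A r c)⁻¹ • (A r c • x - (A.mulVec x r) • Pi.single c 1) +
          ((A r c)⁻¹ * A.mulVec x r) • Pi.single c 1 := by
        rw [smul_sub, smul_smul, smul_smul, inv_mul_cancel₀ h, one_smul, sub_add_cancel]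
      rw [h2]
      exact Submodule.add_mem_sup (Submodule.smul_mem _ _ h1)
        (Submodule.smul_mem _ _ (Submodule.mem_span_singleton_self _))
    · intro hx
      obtain ⟨y, hy, z, hz, rfl⟩ := Submodule.mem_sup.1 hx
      obtain ⟨a, rfl⟩ := Submodule.mem_span_singleton.1 hz
      have hy' : A.mulVec y = 0 := hy
      have h3 : A.mulVec (y + a • Pi.single c 1) r = a * A r c := by
        rw [Matrix.mulVec_add, hy', Matrix.mulVec_smul]
        simp
      rw [h3, smul_add, smul_smul, mul_comm a, add_sub_cancel_right, Matrix.mulVec_smul, hy',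
        smul_zero]
  have hnot : (Pi.single c (1 : F) : n → F) ∉ LinearMap.ker A.mulVecLin := by
    intro hc
    have h1 : A.mulVec (Pi.single c 1) = 0 := hc
    apply h
    have := congrFun h1 r
    simpa [Matrix.mulVec_single_one] using this
  have hdim : Module.finrank F (LinearMap.ker B.mulVecLin) =
      Module.finrank F (LinearMap.ker A.mulVecLin) + 1 := by
    rw [hker, Submodule.finrank_sup_span_singleton hnot]
  have hA := LinearMap.finrank_range_add_finrank_ker A.mulVecLin
  have hB' := LinearMap.finrank_range_add_finrank_ker B.mulVecLin
  change A.rank + _ = _ at hA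
  change B.rank + _ = _ at hB'
  omega

open ArrExpr ArrStmt in
/-- One step of rank reduction of the array `2`, with pivot `(x₅, x₆)` and the array `3` as a
buffer. -/
def reduceStep : ArrStmt :=
  .seq (.fill 3 7 8 .skip (fadd (fmul (entry 2 (.var 5) (.var 6)) (entry 2 (.var 7) (.var 8)))
      (fmul (entry 2 (.var 7) (.var 6)) (entry 2 (.var 5) (.var 8)))))
    (.fill 2 7 8 .skip (entry 3 (.var 7) (.var 8)))

open ArrExpr ArrStmt in
/-- A step of rank reduction if the entry `(x₅, x₆)` is not zero; such steps are counted in the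
variable `3`. -/
def rankStep : ArrStmt :=
  .ite (neq (entry 2 (.var 5) (.var 6)) (.var 1))
    (.seq reduceStep (.set 3 (.add (.var 3) (.lit 1)))) .skip

open ArrStmt in
/-- Computes the rank of the matrix in the array `2` into the variable `3`. The code of the
zero of the field is in the variable `1`. -/
def rankProg : ArrStmt :=
  .seq (.set 3 (.lit 0)) (.loop 5 (.loop 6 rankStep))

section

variable {F : Type} [Field F] [CharP F 2] {q : ℕ} {ν : F ≃ Fin q}

/-- Every new entry needs the old pivot row and column, so the result is built in the buffer and
then copied back. In characteristic 2 the subtraction is a lookup in the addition table. -/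
theorem run_reduceStep {e : ArrEnv} (he : e.HasTables ν) {A : Matrix (Fin q) (Fin q) F}
    (hA : e.HasMatrix ν 2 A) {r c : Fin q} (hr : e.var 5 = r) (hc : e.var 6 = c) :
    (reduceStep.run e).HasMatrix ν 2 (Matrix.of fun i j => A r c * A i j - A i c * A r j) := by
  set B : Matrix (Fin q) (Fin q) F := Matrix.of fun i j => A r c * A i j - A i c * A r j with hB
  have h1 : ((ArrStmt.fill 3 7 8 .skip (.fadd (.fmul (.entry 2 (.var 5) (.var 6))
      (.entry 2 (.var 7) (.var 8))) (.fmul (.entry 2 (.var 7) (.var 6))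
      (.entry 2 (.var 5) (.var 8))))).run e).HasMatrix ν 3 B := by
    refine ArrStmt.run_fill rfl rfl (by simp [ArrStmt.vars]) (by simp [ArrStmt.vars]) (by decide)
      he.size _ fun i j u hu hi hj => ?_
    have hT := he.frame hu
    have hM := hA.frame hu (by decide)
    have h5 : (ArrExpr.var 5).eval u = r := by
      simpa [ArrExpr.eval, hr] using hu.var 5 (by simp [ArrStmt.vars])
    have h6 : (ArrExpr.var 6).eval u = c := by
      simpa [ArrExpr.eval, hc] using hu.var 6 (by simp [ArrStmt.vars])
    have hi' : (ArrExpr.var 7).eval u = i := hi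
    have hj' : (ArrExpr.var 8).eval u = j := hj
    simp only [ArrStmt.run]
    rw [hB, Matrix.of_apply, CharTwo.sub_eq_add]
    exact ArrExpr.eval_fadd hT (ArrExpr.eval_fmul hT (ArrExpr.eval_entry hT.size hM h5 h6)
      (ArrExpr.eval_entry hT.size hM hi' hj')) (ArrExpr.eval_fmul hT
      (ArrExpr.eval_entry hT.size hM hi' h6) (ArrExpr.eval_entry hT.size hM h5 hj'))
  simp only [reduceStep, ArrStmt.run]
  refine ArrStmt.run_fill rfl rfl (by simp [ArrStmt.vars]) (by simp [ArrStmt.vars]) (by decide)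
    (by rw [ArrStmt.run_size, he.size]) _ fun i j u hu hi hj => ?_
  have hi' : (ArrExpr.var 7).eval u = i := hi
  have hj' : (ArrExpr.var 8).eval u = j := hj
  exact ArrExpr.eval_entry (by rw [hu.size, ArrStmt.run_size, he.size]) (h1.frame hu (by decide))
    hi' hj'

/-- The count plus the rank of the current matrix is invariant. A reduction with pivot in row `n`
annihilates all of row `n` and keeps zero rows zero, so one row-by-row pass over the positions ends
with the zero matrix. -/
theorem run_rankProg {e : ArrEnv} (he : e.HasTables ν) (h1 : e.var 1 = ν 0)
    {A : Matrix (Fin q) (Fin q) F} (hA : e.HasMatrix ν 2 A) :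
    (rankProg.run e).var 3 = A.rank := by
  set e₀ := e.setVar 3 0 with he₀
  have hT₀ : e₀.HasTables ν := he.frame (.setVar e 3 0)
  have outer : ∃ B : Matrix (Fin q) (Fin q) F, (rankProg.run e).HasMatrix ν 2 B ∧
      (rankProg.run e).var 3 + B.rank = A.rank ∧ ∀ i j : Fin q, (i : ℕ) < e₀.size → B i j = 0 := by
    refine ArrStmt.run_for (e := e₀) (x := 5) (P := .loop 6 rankStep) rfl
      (fun n u => ∃ B : Matrix (Fin q) (Fin q) F, ArrEnv.HasMatrix ν 2 B u ∧
      u.var 3 + B.rank = A.rank ∧ ∀ i j : Fin q, (i : ℕ) < n → B i j = 0) ⟨A, hA, by simp [he₀], fun i j hi => by omega⟩ ?_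
    rintro n hn u hu ⟨B, hB, hrank, hzero⟩
    rw [hT₀.size] at hn
    have hTu := hT₀.frame hu
    have hTu' : (u.setVar 5 n).HasTables ν := hTu.frame (.setVar u 5 n)
    have hu1 : u.var 1 = ν 0 := by
      rw [hu.var 1 (by decide)]; simpa [he₀] using h1
    have inner := ArrStmt.run_for (e := u.setVar 5 n) (x := 6)
      (P := rankStep) rfl
      (fun m v => ∃ B : Matrix (Fin q) (Fin q) F, ArrEnv.HasMatrix ν 2 B v ∧
        v.var 3 + B.rank = A.rank ∧ ∀ i j : Fin q, ((i : ℕ) < n ∨ (i : ℕ) = n ∧ (j : ℕ) < m) →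
          B i j = 0)
      ⟨B, hB, by simpa using hrank, fun i j hij => hzero i j (by omega)⟩ ?_
    · obtain ⟨B', hB', hrank', hzero'⟩ := inner
      refine ⟨B', hB', hrank', fun i j hi => hzero' i j ?_⟩
      have := j.2
      rw [hTu'.size]
      omega
    · rintro m hm v hv ⟨C, hC, hrank, hzero⟩
      rw [hTu'.size] at hm
      have hTv : (v.setVar 6 m).HasTables ν := (hTu'.frame hv).frame (.setVar v 6 m)
      have h5 : (v.setVar 6 m).var 5 = n := by
        simpa using hv.var 5 (by decide)
      have hv1 : (v.setVar 6 m).var 1 = ν 0 := by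
        have := hv.var 1 (by decide)
        simpa [hu1] using this
      have hC' : (v.setVar 6 m).HasMatrix ν 2 C := hC
      have hentry := ArrExpr.eval_entry hTv.size hC' (a := .var 5) (b := .var 6)
        (i := ⟨n, hn⟩) (j := ⟨m, hm⟩) h5 (by simp [ArrExpr.eval])
      have hiff : (ArrExpr.neq (.entry 2 (.var 5) (.var 6)) (.var 1)).eval (v.setVar 6 m) ≠ 0 ↔
          C ⟨n, hn⟩ ⟨m, hm⟩ ≠ 0 := by
        rw [ArrExpr.eval_neq_ne_zero, hentry, ArrExpr.eval, hv1, ne_eq, Fin.val_inj,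
          ν.injective.eq_iff]
      rw [rankStep, ArrStmt.run]
      by_cases hz : C ⟨n, hn⟩ ⟨m, hm⟩ = 0
      · rw [if_neg (by rw [hiff]; simpa using hz)]
        refine ⟨C, hC, by simpa [ArrStmt.run] using hrank, fun i j hij => ?_⟩
        by_cases hcase : (i : ℕ) = n ∧ (j : ℕ) = m
        · obtain ⟨rfl, rfl⟩ := hcase
          exact hz
        · exact hzero i j (by omega)
      · rw [if_pos (hiff.2 hz)]
        refine ⟨_, run_reduceStep hTv hC' (r := ⟨n, hn⟩) (c := ⟨m, hm⟩) h5 (by simp), ?_, ?_⟩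
        · have := Matrix.rank_reduction C hz
          have h3 : (reduceStep.run (v.setVar 6 m)).var 3 = v.var 3 := by
            rw [(reduceStep.run_frame rfl _).var 3 (by decide)]; simp
          simp only [ArrStmt.run, ArrExpr.eval, ArrEnv.setVar_var, if_true, h3]
          omega
        · intro i j hij
          rw [Matrix.of_apply]
          by_cases hin : (i : ℕ) < n
          · rw [hzero i j (Or.inl hin), hzero i _ (Or.inl hin)]; ring
          · have : i = ⟨n, hn⟩ := Fin.ext (by simp; omega)
            subst this; ring
  obtain ⟨B, -, hrank, hzero⟩ := outer
  have hB : B = 0 := by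
    ext i j
    exact hzero i j (by rw [hT₀.size]; exact i.2)
  rw [hB, Matrix.rank_zero] at hrank
  omega

end

/-! ### The decoder as an array program -/

section

variable {F : Type} [Field F]

/-- The rows of this matrix are the vectors `(1, x, x ^ 2, …)` for the evaluation points
`x = γ ^ i`, truncated to the exponents `a` with `20 * a < q`. -/
def pointMatrix (q : ℕ) (γ : F) : Matrix (Fin q) (Fin q) F :=
  Matrix.of fun i a => if (i : ℕ) + 1 < q ∧ 20 * (a : ℕ) < q then γ ^ ((i : ℕ) * a) else 0

/-- The Hankel matrix of the syndromes of a word. -/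
def syndromeMatrix {q : ℕ} (γ : F) (z : Fin q → F) : Matrix (Fin q) (Fin q) F :=
  Matrix.of fun a b => ∑ i, z i * (pointMatrix q γ i a * pointMatrix q γ i b)

/-- The syndrome matrix after the addition of `v` to the letter `i`. -/
def modifiedMatrix {q : ℕ} (γ : F) (z : Fin q → F) (i : Fin q) (v : F) :
    Matrix (Fin q) (Fin q) F :=
  Matrix.of fun a b => syndromeMatrix γ z a b + v * (pointMatrix q γ i a * pointMatrix q γ i b)

/-- `x` is the result of decoding the letter `i`: if the addition of some `v` to this letter reduces
the rank of the syndrome matrix then such a `v` is added, otherwise the letter is kept. -/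
def IsDecodedLetter {q : ℕ} (γ : F) (z : Fin q → F) (i : Fin q) (x : F) : Prop :=
  (∃ v, (modifiedMatrix γ z i v).rank < (syndromeMatrix γ z).rank ∧ x = z i + v) ∨
    (∀ v, ¬ (modifiedMatrix γ z i v).rank < (syndromeMatrix γ z).rank) ∧ x = z i

end

open ArrExpr

/-- `20 * a` -/
def ArrExpr.twenty (a : ArrExpr) : ArrExpr :=
  let b := .add (.add (.add a a) (.add a a)) a
  .add (.add b b) (.add b b)

/-- The letter with a given index of the received word. -/
def ArrExpr.letter (a : ArrExpr) : ArrExpr :=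
  .inp (.add (.add (.lit 2) (.add (.scale .size) (.scale .size))) a)

/-- Puts the entry `(x₆, x₇)` of the point matrix into the variable `8`. -/
def pointProg : ArrStmt :=
  .seq (.set 8 (.var 1)) (.ite (.sub .size (.add (.var 6) (.lit 1)))
    (.ite (.sub .size (twenty (.var 7)))
      (.seq (.set 8 (.var 2)) (.loop 9 (.ite (.sub (.var 6) (.var 9))
        (.loop 10 (.ite (.sub (.var 7) (.var 10)) (.set 8 (fmul (.var 8) (.var 0))) .skip)) .skip)))
      .skip) .skip)

/-- Puts the entry `(x₆, x₇)` of the syndrome matrix into the variable `8`. -/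
def syndromeProg : ArrStmt :=
  .seq (.set 8 (.var 1)) (.loop 9 (.set 8 (fadd (.var 8) (fmul (letter (.var 9))
    (fmul (entry 0 (.var 9) (.var 6)) (entry 0 (.var 9) (.var 7)))))))

/-- Computes the constants of the field: `γ`, zero and one. -/
def constProg : ArrStmt :=
  .seq (.set 0 (.inp (.lit 1))) (.seq (.set 1 (fadd (.var 0) (.var 0)))
    (.loop 5 (.ite (neq (fmul (.var 0) (.var 5)) (.var 0)) .skip (.set 2 (.var 5)))))

/-- Array `0` keeps the point matrix and array `1` the syndrome matrix. The rank computation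
destroys its argument and therefore works on a copy in array `2`. -/
def initProg : ArrStmt :=
  .seq constProg (.seq (.fill 0 6 7 pointProg (.var 8)) (.seq (.fill 1 6 7 syndromeProg (.var 8))
    (.seq (.fill 2 6 7 .skip (entry 1 (.var 6) (.var 7))) (.seq rankProg (.set 4 (.var 3))))))

/-- Tests whether adding `x₁₂` to the letter `x₁₁` reduces the rank. -/
def tryProg : ArrStmt :=
  .seq (.fill 2 6 7 .skip (fadd (entry 1 (.var 6) (.var 7)) (fmul (.var 12)
      (fmul (entry 0 (.var 11) (.var 6)) (entry 0 (.var 11) (.var 7))))))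
    (.seq rankProg (.ite (.sub (.var 4) (.var 3))
      (.put 4 (.var 11) (fadd (letter (.var 11)) (.var 12))) .skip))

def letterProg : ArrStmt :=
  .seq (.put 4 (.var 11) (letter (.var 11))) (.loop 12 tryProg)

/-- The decoded letters are collected in array `4` and written out only at the end, because the
output overwrites the tables. -/
def decodeProg : ArrStmt :=
  .seq initProg (.seq (.loop 11 letterProg) (.loop 13 (.out (.var 13) (.get 4 (.var 13)))))

/-- The input of the decoder is in the input memory. -/
structure ArrEnv.HasInput {F : Type} [Field F] {q : ℕ} (ν : F ≃ Fin q) (γ : F) (z : Fin q → F)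
    (e : ArrEnv) : Prop extends e.HasTables ν where
  base_le : 2 + (q * q + q * q) + q ≤ e.base
  gen : e.inp 1 = ν γ
  word : ∀ i : Fin q, e.inp (2 + (q * q + q * q) + i) = ν (z i)

/-- The constants of the field are in the variables `0`, `1`, `2`. -/
structure ArrEnv.HasConstants {F : Type} [Field F] {q : ℕ} (ν : F ≃ Fin q) (γ : F)
    (e : ArrEnv) : Prop where
  generator : e.var 0 = ν γ
  zero : e.var 1 = ν 0
  one : e.var 2 = ν 1

/-! ### Correctness of the array program -/

section

variable {F : Type} [Field F] {q : ℕ} {ν : F ≃ Fin q} {γ : F} {z : Fin q → F}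

theorem ArrEnv.HasInput.frame {e u : ArrEnv} (h : e.HasInput ν γ z) {X : List ℕ}
    {K : List (Fin 8)} (hu : e.Frame X K u) : u.HasInput ν γ z := by
  refine ⟨h.toHasTables.frame hu, hu.base ▸ h.base_le, ?_, ?_⟩ <;> rw [hu.inp]
  exacts [h.gen, h.word]

theorem ArrEnv.HasConstants.frame {e u : ArrEnv} (h : e.HasConstants ν γ) {X : List ℕ}
    {K : List (Fin 8)} (hu : e.Frame X K u) (h0 : 0 ∉ X) (h1 : 1 ∉ X) (h2 : 2 ∉ X) :
    u.HasConstants ν γ :=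
  ⟨(hu.var 0 h0).trans h.generator, (hu.var 1 h1).trans h.zero, (hu.var 2 h2).trans h.one⟩

theorem ArrExpr.eval_letter {e : ArrEnv} (h : e.HasInput ν γ z) {a : ArrExpr} {i : Fin q}
    (ha : a.eval e = i) : (letter a).eval e = ν (z i) := by
  have := h.base_le
  have := i.2
  simp only [letter, eval, ha, h.size]
  rw [if_pos (by omega), h.word]

theorem ArrExpr.eval_twenty (e : ArrEnv) (a : ArrExpr) : (twenty a).eval e = 20 * a.eval e := by
  simp only [twenty, eval]; ring

/-- The numbering is arbitrary, so the codes of `0` and `1` have to be found: `0 = γ + γ` in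
characteristic 2, and `1` is the only `y` with `γ * y = γ`. -/
theorem run_constProg [CharP F 2] (hγ : γ ≠ 0) {e : ArrEnv} (he : e.HasInput ν γ z) :
    (constProg.run e).HasConstants ν γ := by
  have hbase := he.base_le
  set e₁ := e.setVar 0 (ν γ) with he₁
  set e₂ := e₁.setVar 1 (ν 0) with he₂
  have h₁ : e₁.HasInput ν γ z := he.frame (.setVar _ _ _)
  have h₂ : e₂.HasInput ν γ z := h₁.frame (.setVar _ _ _)
  have hrun : constProg.run e = (ArrStmt.loop 5 (.ite (neq (fmul (.var 0) (.var 5)) (.var 0)) .skip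
      (.set 2 (.var 5)))).run e₂ := by
    have hg : (ArrExpr.inp (.lit 1)).eval e = ν γ := by
      rw [eval, if_pos (by simp only [eval]; omega)]; exact he.gen
    have hz : (fadd (.var 0) (.var 0)).eval e₁ = ν 0 := by
      rw [eval_fadd h₁.toHasTables (x := γ) (y := γ) (by simp [eval, he₁]) (by simp [eval, he₁]),
        CharTwo.add_self_eq_zero]
    simp only [constProg, ArrStmt.run, hg, ← he₁, hz, ← he₂]
  rw [hrun]
  have hf := (ArrStmt.loop 5 (.ite (neq (fmul (.var 0) (.var 5)) (.var 0)) .skip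
      (.set 2 (.var 5)))).run_frame rfl e₂
  refine ⟨(hf.var 0 (by decide)).trans (by simp [he₂, he₁]), (hf.var 1 (by decide)).trans
    (by simp [he₂]), ?_⟩
  refine ArrStmt.run_for (e := e₂) rfl (fun n u => (ν (1 : F) : ℕ) < n → u.var 2 = ν 1)
    (fun h => by omega) (fun n hn u hu hI => ?_) (by rw [h₂.size]; exact (ν 1).2)
  rw [h₂.size] at hn
  have hu' : (u.setVar 5 n).HasInput ν γ z := (h₂.frame hu).frame (.setVar _ _ _)
  have h0 : u.var 0 = ν γ := by rw [hu.var 0 (by decide)]; simp [he₂, he₁]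
  have hmul : (fmul (.var 0) (.var 5)).eval (u.setVar 5 n) = ν (γ * ν.symm ⟨n, hn⟩) :=
    eval_fmul hu'.toHasTables (by simp [eval, h0]) (by simp [eval])
  have hiff : (neq (fmul (.var 0) (.var 5)) (.var 0)).eval (u.setVar 5 n) ≠ 0 ↔
      (ν 1 : ℕ) ≠ n := by
    rw [eval_neq_ne_zero, hmul]
    simp only [eval, ArrEnv.setVar_var, h0, ne_eq]
    rw [if_neg (by decide), Fin.val_inj, ν.injective.eq_iff, mul_eq_left₀ hγ, Equiv.symm_apply_eq,
      Fin.ext_iff]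
    exact not_congr eq_comm
  rw [ArrStmt.run]
  by_cases hc : (ν (1 : F) : ℕ) = n
  · rw [if_neg (by rw [hiff]; simpa using hc)]
    intro _
    simp [ArrStmt.run, eval, hc]
  · rw [if_pos (hiff.2 hc)]
    intro h
    simp only [ArrStmt.run, ArrEnv.setVar_var]
    rw [if_neg (by decide)]
    exact hI (by omega)

/-- The power is obtained by `i * a` multiplications by `γ`. Since all loops have length `q`, the
conditionals switch off the iterations beyond `i` and `a`, whence the minima in the invariants. -/
theorem run_pointProg {e : ArrEnv} (he : e.HasTables ν) (hc : e.HasConstants ν γ) {i a : Fin q}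
    (hi : e.var 6 = i) (ha : e.var 7 = a) :
    (pointProg.run e).var 8 = ν (pointMatrix q γ i a) := by
  set e₁ := e.setVar 8 (ν 0) with he₁
  have h1 : (ArrExpr.var 1).eval e = ν 0 := hc.zero
  have hs1 : (ArrExpr.sub .size (.add (.var 6) (.lit 1))).eval e₁ = q - (i + 1) := by
    simp [eval, he₁, he.size, hi]
  have hs2 : (ArrExpr.sub .size (twenty (.var 7))).eval e₁ = q - 20 * a := by
    rw [eval, eval_twenty]; simp [eval, he₁, he.size, ha]
  rw [pointProg, ArrStmt.run, ArrStmt.run, h1, ← he₁, ArrStmt.run, hs1]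
  rw [pointMatrix, Matrix.of_apply]
  by_cases c1 : (i : ℕ) + 1 < q
  swap
  · rw [if_neg (by omega), if_neg (by omega)]; simp [ArrStmt.run, he₁]
  rw [if_pos (by omega), ArrStmt.run, hs2]
  by_cases c2 : 20 * (a : ℕ) < q
  swap
  · rw [if_neg (by omega), if_neg (by omega)]; simp [ArrStmt.run, he₁]
  rw [if_pos (by omega), if_pos ⟨c1, c2⟩, ArrStmt.run, ArrStmt.run]
  have h2 : (ArrExpr.var 2).eval e₁ = ν 1 := by simp [eval, he₁, hc.one]
  rw [h2]
  set e₂ := e₁.setVar 8 (ν 1) with he₂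
  have ht₂ : e₂.HasTables ν := (he.frame (.setVar _ _ _)).frame (.setVar e₁ _ _)
  have outer := ArrStmt.run_for (e := e₂) (x := 9) (P := .ite (.sub (.var 6) (.var 9))
        (.loop 10 (.ite (.sub (.var 7) (.var 10)) (.set 8 (fmul (.var 8) (.var 0))) .skip)) .skip)
    rfl (fun n u => u.var 8 = ν (γ ^ (min (i : ℕ) n * a))) (by simp [he₂]) ?_
  · rw [outer, ht₂.size, min_eq_left i.2.le]
  intro n hn u hu hI
  have h6 : u.var 6 = i := by rw [hu.var 6 (by decide)]; simp [he₂, he₁, hi]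
  have h7 : u.var 7 = a := by rw [hu.var 7 (by decide)]; simp [he₂, he₁, ha]
  have h0 : u.var 0 = ν γ := by rw [hu.var 0 (by decide)]; simp [he₂, he₁, hc.generator]
  rw [ArrStmt.run]
  by_cases hin : n < i
  swap
  · rw [if_neg (by simp [eval, h6]; omega)]
    simp only [ArrStmt.run, ArrEnv.setVar_var]
    rw [if_neg (by decide), hI, min_eq_left (by omega), min_eq_left (by omega)]
  rw [if_pos (by simp [eval, h6]; omega)]
  have htu : (u.setVar 9 n).HasTables ν := (ht₂.frame hu).frame (.setVar _ _ _)
  have inner := ArrStmt.run_for (e := u.setVar 9 n) (x := 10)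
    (P := .ite (.sub (.var 7) (.var 10)) (.set 8 (fmul (.var 8) (.var 0))) .skip)
    rfl (fun m v => v.var 8 = ν (γ ^ (n * a + min (a : ℕ) m))) ?_ ?_
  · rw [inner, htu.size, min_eq_left a.2.le, min_eq_right (by omega)]
    congr 3; ring
  · simpa [min_eq_right hin.le] using hI
  intro m hm v hv hJ
  have h7 : v.var 7 = a := by rw [hv.var 7 (by decide)]; simpa using h7
  have h0 : v.var 0 = ν γ := by rw [hv.var 0 (by decide)]; simpa using h0
  rw [ArrStmt.run]
  by_cases hma : m < a
  · rw [if_pos (by simp [eval, h7]; omega)]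
    have := eval_fmul ((htu.frame hv).frame (.setVar v 10 m)) (a := .var 8) (b := .var 0)
      (x := γ ^ (n * a + min (a : ℕ) m)) (y := γ) (by simp [eval, hJ]) (by simp [eval, h0])
    simp only [ArrStmt.run, ArrEnv.setVar_var, if_true, this]
    rw [← pow_succ, min_eq_right hma.le, min_eq_right (by omega), add_assoc]
  · rw [if_neg (by simp [eval, h7]; omega)]
    simp only [ArrStmt.run, ArrEnv.setVar_var]
    rw [if_neg (by decide), hJ, min_eq_left (by omega), min_eq_left (by omega)]

theorem run_syndromeProg {e : ArrEnv} (he : e.HasInput ν γ z) (hc : e.HasConstants ν γ)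
    (hU : e.HasMatrix ν 0 (pointMatrix q γ)) {a b : Fin q} (ha : e.var 6 = a) (hb : e.var 7 = b) :
    (syndromeProg.run e).var 8 = ν (syndromeMatrix γ z a b) := by
  have h1 : (ArrExpr.var 1).eval e = ν 0 := hc.zero
  rw [syndromeProg, ArrStmt.run, ArrStmt.run, h1]
  set e₁ := e.setVar 8 (ν 0) with he₁
  have h₁ : e₁.HasInput ν γ z := he.frame (.setVar _ _ _)
  set f : ℕ → F := fun i => if h : i < q then z ⟨i, h⟩ * (pointMatrix q γ ⟨i, h⟩ a *
    pointMatrix q γ ⟨i, h⟩ b) else 0 with hf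
  have outer := ArrStmt.run_for (e := e₁) (x := 9) (P := .set 8 (fadd (.var 8) (fmul
    (letter (.var 9)) (fmul (entry 0 (.var 9) (.var 6)) (entry 0 (.var 9) (.var 7))))))
    rfl (fun n u => u.var 8 = ν (∑ i ∈ Finset.range n, f i)) (by simp [he₁]) ?_
  · rw [outer, h₁.size, syndromeMatrix, Matrix.of_apply, Finset.sum_range]
    simp [hf]
  intro n hn u hu hI
  rw [h₁.size] at hn
  have hu' : (u.setVar 9 n).HasInput ν γ z := (h₁.frame hu).frame (.setVar _ _ _)
  have hUu : (u.setVar 9 n).HasMatrix ν 0 (pointMatrix q γ) :=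
    ((hU.frame (.setVar e 8 (ν 0)) (by simp)).frame hu (by decide)).frame (.setVar u 9 n) (by simp)
  have h6 : u.var 6 = a := by rw [hu.var 6 (by decide)]; simp [he₁, ha]
  have h7 : u.var 7 = b := by rw [hu.var 7 (by decide)]; simp [he₁, hb]
  have h9 : (ArrExpr.var 9).eval (u.setVar 9 n) = (⟨n, hn⟩ : Fin q) := by simp [eval]
  have := eval_fadd hu'.toHasTables (a := .var 8) (x := ∑ i ∈ Finset.range n, f i)
    (by simp [eval, hI]) (eval_fmul hu'.toHasTables (eval_letter hu' h9)
      (eval_fmul hu'.toHasTables (eval_entry hu'.size hUu h9 (b := .var 6) (j := a)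
        (by simp [eval, h6])) (eval_entry hu'.size hUu h9 (b := .var 7) (j := b)
        (by simp [eval, h7]))))
  rw [ArrStmt.run, this, Finset.sum_range_succ]
  simp [hf, hn]

/-- The state after the initialization. -/
structure ArrEnv.IsReady (ν : F ≃ Fin q) (γ : F) (z : Fin q → F) (e : ArrEnv) : Prop
    extends e.HasInput ν γ z, e.HasConstants ν γ where
  points : e.HasMatrix ν 0 (pointMatrix q γ)
  syndromes : e.HasMatrix ν 1 (syndromeMatrix γ z)
  rank : e.var 4 = (syndromeMatrix γ z).rank

theorem ArrEnv.IsReady.frame {e u : ArrEnv} (h : e.IsReady ν γ z) {X : List ℕ}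
    {K : List (Fin 8)} (hu : e.Frame X K u) (h0 : 0 ∉ X) (h1 : 1 ∉ X) (h2 : 2 ∉ X) (h4 : 4 ∉ X)
    (k0 : 0 ∉ K) (k1 : 1 ∉ K) : u.IsReady ν γ z :=
  { h.toHasInput.frame hu, h.toHasConstants.frame hu h0 h1 h2 with
    points := h.points.frame hu k0
    syndromes := h.syndromes.frame hu k1
    rank := (hu.var 4 h4).trans h.rank }

theorem run_initProg [CharP F 2] (hγ : γ ≠ 0) {e : ArrEnv} (he : e.HasInput ν γ z) :
    (initProg.run e).IsReady ν γ z := by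
  rw [initProg, ArrStmt.run, ArrStmt.run, ArrStmt.run, ArrStmt.run, ArrStmt.run]
  set e₁ := constProg.run e with he₁
  have hc₁ : e₁.HasConstants ν γ := run_constProg hγ he
  have hi₁ : e₁.HasInput ν γ z := he.frame (constProg.run_frame rfl e)
  set e₂ := (ArrStmt.fill 0 6 7 pointProg (.var 8)).run e₁ with he₂
  have f₂ : e₁.Frame _ _ e₂ := ArrStmt.run_frame _ rfl _
  have hU₂ : e₂.HasMatrix ν 0 (pointMatrix q γ) :=
    ArrStmt.run_fill rfl rfl (by decide) (by decide) (by decide) hi₁.size _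
      fun i j u hu hi hj => run_pointProg (hi₁.frame hu).toHasTables
        (hc₁.frame hu (by decide) (by decide) (by decide)) hi hj
  have hi₂ := hi₁.frame f₂
  have hc₂ := hc₁.frame f₂ (by decide) (by decide) (by decide)
  set e₃ := (ArrStmt.fill 1 6 7 syndromeProg (.var 8)).run e₂ with he₃
  have f₃ : e₂.Frame _ _ e₃ := ArrStmt.run_frame _ rfl _
  have hH₃ : e₃.HasMatrix ν 1 (syndromeMatrix γ z) :=
    ArrStmt.run_fill rfl rfl (by decide) (by decide) (by decide) hi₂.size _
      fun i j u hu hi hj => run_syndromeProg (hi₂.frame hu)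
        (hc₂.frame hu (by decide) (by decide) (by decide)) (hU₂.frame hu (by decide)) hi hj
  have hi₃ := hi₂.frame f₃
  have hc₃ := hc₂.frame f₃ (by decide) (by decide) (by decide)
  have hU₃ := hU₂.frame f₃ (by decide)
  set e₄ := (ArrStmt.fill 2 6 7 .skip (entry 1 (.var 6) (.var 7))).run e₃ with he₄
  have f₄ : e₃.Frame _ _ e₄ := ArrStmt.run_frame _ rfl _
  have hM₄ : e₄.HasMatrix ν 2 (syndromeMatrix γ z) :=
    ArrStmt.run_fill rfl rfl (by decide) (by decide) (by decide) hi₃.size _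
      fun i j u hu hi hj => eval_entry (hi₃.frame hu).size (hH₃.frame hu (by decide)) hi hj
  have hi₄ := hi₃.frame f₄
  have hc₄ := hc₃.frame f₄ (by decide) (by decide) (by decide)
  have hU₄ := hU₃.frame f₄ (by decide)
  have hH₄ := hH₃.frame f₄ (by decide)
  have f₅ := rankProg.run_frame rfl e₄
  have hi₅ := hi₄.frame f₅
  have hc₅ := hc₄.frame f₅ (by decide) (by decide) (by decide)
  have hU₅ := hU₄.frame f₅ (by decide)
  have hH₅ := hH₄.frame f₅ (by decide)
  have hr := run_rankProg hi₄.toHasTables hc₄.zero hM₄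
  have f₆ := ArrEnv.Frame.setVar (rankProg.run e₄) 4 ((rankProg.run e₄).var 3)
  exact { hi₅.frame f₆, hc₅.frame f₆ (by decide) (by decide) (by decide) with
    points := hU₅.frame f₆ (by decide)
    syndromes := hH₅.frame f₆ (by decide)
    rank := by simp [ArrStmt.run, eval, hr] }

open Classical in
theorem run_tryProg [CharP F 2] {e : ArrEnv} (he : e.IsReady ν γ z) {i : Fin q} {v : F}
    (hi : e.var 11 = i) (hv : e.var 12 = ν v) (j : ℕ) :
    (tryProg.run e).arr 4 j =
      if (modifiedMatrix γ z i v).rank < (syndromeMatrix γ z).rank ∧ j = i then (ν (z i + v) : ℕ)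
      else e.arr 4 j := by
  rw [tryProg, ArrStmt.run, ArrStmt.run, ArrStmt.run]
  set e₁ := (ArrStmt.fill 2 6 7 .skip (fadd (entry 1 (.var 6) (.var 7)) (fmul (.var 12)
      (fmul (entry 0 (.var 11) (.var 6)) (entry 0 (.var 11) (.var 7)))))).run e with he₁
  have f₁ : e.Frame _ _ e₁ := ArrStmt.run_frame _ rfl _
  have hM : e₁.HasMatrix ν 2 (modifiedMatrix γ z i v) := by
    refine ArrStmt.run_fill rfl rfl (by decide) (by decide) (by decide) he.size _
      fun a b u hu ha hb => ?_
    have hu' := he.frame hu (by decide) (by decide) (by decide) (by decide) (by decide) (by decide)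
    have h11 : (ArrExpr.var 11).eval u = i := (hu.var 11 (by decide)).trans hi
    have h12 : (ArrExpr.var 12).eval u = ν v := (hu.var 12 (by decide)).trans hv
    exact eval_fadd hu'.toHasTables (eval_entry hu'.size hu'.syndromes ha hb)
      (eval_fmul hu'.toHasTables h12 (eval_fmul hu'.toHasTables
        (eval_entry hu'.size hu'.points h11 ha) (eval_entry hu'.size hu'.points h11 hb)))
  have hr₁ := he.frame f₁ (by decide) (by decide) (by decide) (by decide) (by decide) (by decide)
  have hrank := run_rankProg hr₁.toHasTables hr₁.zero hM
  have f₂ := rankProg.run_frame rfl e₁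
  have hr₂ := hr₁.frame f₂ (by decide) (by decide) (by decide) (by decide) (by decide) (by decide)
  set e₂ := rankProg.run e₁ with he₂
  have h11 : e₂.var 11 = i := by rw [f₂.var 11 (by decide), f₁.var 11 (by decide), hi]
  have h12 : e₂.var 12 = ν v := by rw [f₂.var 12 (by decide), f₁.var 12 (by decide), hv]
  have harr : e₂.arr 4 = e.arr 4 := by rw [f₂.arr 4 (by decide), f₁.arr 4 (by decide)]
  have htest : (ArrExpr.sub (.var 4) (.var 3)).eval e₂ =
      (syndromeMatrix γ z).rank - (modifiedMatrix γ z i v).rank := by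
    simp only [eval, hr₂.rank, hrank]
  rw [htest]
  by_cases hlt : (modifiedMatrix γ z i v).rank < (syndromeMatrix γ z).rank
  · rw [if_pos (by omega)]
    have hadd := eval_fadd hr₂.toHasTables (eval_letter hr₂.toHasInput (a := .var 11) h11)
      (b := .var 12) h12
    rw [ArrStmt.run, hadd, ArrEnv.setArr_arr_self]
    simp [eval, h11, hlt, harr]
  · rw [if_neg (by omega)]
    simp [ArrStmt.run, hlt, harr]

theorem run_letterProg [CharP F 2] {e : ArrEnv} (he : e.IsReady ν γ z) {i : Fin q}
    (hi : e.var 11 = i) :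
    (∃ x, (letterProg.run e).arr 4 i = ν x ∧ IsDecodedLetter γ z i x) ∧
      ∀ j, j ≠ (i : ℕ) → (letterProg.run e).arr 4 j = e.arr 4 j := by
  rw [letterProg, ArrStmt.run, ArrStmt.run, eval_letter he.toHasInput (a := .var 11) hi]
  have h11 : (ArrExpr.var 11).eval e = i := hi
  rw [h11]
  set e₁ := e.setArr 4 i (ν (z i)) with he₁
  have f₁ : e.Frame _ _ e₁ := .setArr _ _ _ _
  have hr₁ := he.frame f₁ (by decide) (by decide) (by decide) (by decide) (by decide) (by decide)
  -- A later successful `v` may overwrite an earlier one. This is harmless: the candidate is always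
  -- formed from the received letter, and the invariant only claims that some successful `v` was
  -- used.
  have key := ArrStmt.run_for (e := e₁) (x := 12) (P := tryProg) rfl
    (fun n u => (∃ x, u.arr 4 i = ν x ∧
      ((∃ v, (modifiedMatrix γ z i v).rank < (syndromeMatrix γ z).rank ∧ x = z i + v) ∨
        (∀ v, (ν v : ℕ) < n → ¬ (modifiedMatrix γ z i v).rank < (syndromeMatrix γ z).rank) ∧
          x = z i)) ∧ ∀ j, j ≠ (i : ℕ) → u.arr 4 j = e.arr 4 j) ?_ ?_
  · obtain ⟨⟨x, hx, hd⟩, hj⟩ := key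
    refine ⟨⟨x, hx, hd.imp_right fun ⟨h, h'⟩ => ⟨fun v => h v ?_, h'⟩⟩, hj⟩
    rw [hr₁.size]
    exact (ν v).2
  · exact ⟨⟨z i, by simp [he₁, ArrEnv.setArr_arr_self], Or.inr ⟨fun v hv => by omega, rfl⟩⟩,
      fun j hj => by simp [he₁, ArrEnv.setArr_arr_self, hj]⟩
  · rintro n hn u hu ⟨⟨x, hx, hd⟩, hj⟩
    rw [hr₁.size] at hn
    have hr := (hr₁.frame hu (by decide) (by decide) (by decide) (by decide) (by decide)
      (by decide)).frame (.setVar u 12 n) (by decide) (by decide) (by decide) (by decide)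
      (by decide) (by decide)
    have h11 : (u.setVar 12 n).var 11 = i := by
      have := hu.var 11 (by decide)
      simpa [he₁, hi] using this
    have hrun := run_tryProg hr h11 (v := ν.symm ⟨n, hn⟩) (by simp)
    refine ⟨?_, fun j hji => ?_⟩
    · rw [hrun]
      by_cases hlt : (modifiedMatrix γ z i (ν.symm ⟨n, hn⟩)).rank < (syndromeMatrix γ z).rank
      · rw [if_pos ⟨hlt, rfl⟩]
        exact ⟨_, rfl, Or.inl ⟨_, hlt, rfl⟩⟩
      · rw [if_neg fun h => hlt h.1]
        refine ⟨x, hx, hd.imp_right fun ⟨h, h'⟩ => ⟨fun v hv => ?_, h'⟩⟩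
        by_cases hvn : (ν v : ℕ) = n
        · have : v = ν.symm ⟨n, hn⟩ := by
            rw [Equiv.eq_symm_apply]; exact Fin.ext hvn
          rw [this]; exact hlt
        · exact h v (by omega)
    · rw [hrun, if_neg fun h => hji h.2]
      exact hj j hji

theorem run_decodeProg [CharP F 2] (hγ : γ ≠ 0) {e : ArrEnv} (he : e.HasInput ν γ z) :
    ∃ x : Fin q → F, ∀ i : Fin q, (decodeProg.run e).inp i = ν (x i) ∧ IsDecodedLetter γ z i (x i) := by
  rw [decodeProg, ArrStmt.run, ArrStmt.run]
  set e₁ := initProg.run e with he₁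
  have hr₁ : e₁.IsReady ν γ z := run_initProg hγ he
  set e₂ := (ArrStmt.loop 11 letterProg).run e₁ with he₂
  have f₂ : e₁.Frame _ _ e₂ := ArrStmt.run_frame _ rfl _
  have hr₂ := hr₁.frame f₂ (by decide) (by decide) (by decide) (by decide) (by decide) (by decide)
  have hres : ∀ i : Fin q, ∃ x, e₂.arr 4 i = ν x ∧ IsDecodedLetter γ z i x := by
    have key := ArrStmt.run_for (e := e₁) (x := 11) (P := letterProg) rfl
      (fun n u => ∀ i : Fin q, (i : ℕ) < n → ∃ x, u.arr 4 i = ν x ∧ IsDecodedLetter γ z i x)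
      (fun i hi => by omega) ?_
    · exact fun i => key i (by rw [hr₁.size]; exact i.2)
    intro n hn u hu hI i hin
    rw [hr₁.size] at hn
    have hr := (hr₁.frame hu (by decide) (by decide) (by decide) (by decide) (by decide)
      (by decide)).frame (.setVar u 11 n) (by decide) (by decide) (by decide) (by decide)
      (by decide) (by decide)
    have h := run_letterProg hr (i := ⟨n, hn⟩) (by simp)
    by_cases hi : (i : ℕ) = n
    · have : i = ⟨n, hn⟩ := Fin.ext hi
      rw [this]
      exact h.1
    · rw [h.2 _ hi]
      exact hI i (by omega)
  choose x hx hd using hres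
  refine ⟨x, fun i => ⟨?_, hd i⟩⟩
  have hbase := hr₂.base_le
  have key : ∀ i : Fin q, (i : ℕ) < e₂.size →
      ((ArrStmt.loop 13 (.out (.var 13) (.get 4 (.var 13)))).run e₂).inp i = ν (x i) := by
    -- The rule `ArrStmt.run_for` does not apply to a loop that writes output, so the invariant
    -- itself records that `base` and the arrays stay unchanged.
    refine (forIter_invariant (fun n (u : ArrEnv) => u.base = e₂.base ∧ u.arr = e₂.arr ∧
      ∀ i : Fin q, (i : ℕ) < n → u.inp i = ν (x i)) ⟨rfl, rfl, fun i hi => by omega⟩ ?_).2.2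
    rintro n hn u ⟨hb, ha, hI⟩
    rw [hr₂.size] at hn
    simp only [ArrStmt.run, eval, ArrEnv.setVar_var, if_true, ArrEnv.setVar_arr, ArrEnv.setInp,
      ArrEnv.setVar_base, hb]
    rw [if_pos (by omega)]
    refine ⟨rfl, ha, fun i hi => ?_⟩
    simp only [Function.update_apply, ArrEnv.setVar_inp]
    split_ifs with hin
    · rw [← hin, ha, hx]
    · exact hI i (by omega)
  exact key i (by rw [hr₂.size]; exact i.2)

end

/-! ### The decoding machine -/

/-- Puts `q = (n + 1) ^ 2` into the register `0` and `2 + 2 * q ^ 2 + q` into the register `2`. -/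
def prologue : RAMProgram :=
  .seq (.load 1 1) (.seq (.const 3 1) (.seq (.add 5 1 3) (.seq (.add 7 1 3)
    (.seq (.loop 7 (.seq (.add 0 0 5) (.sub 7 7 3))) (.seq (.add 7 0 9)
    (.seq (.loop 7 (.seq (.add 2 2 0) (.sub 7 7 3))) (.seq (.add 2 2 2) (.seq (.add 2 2 0)
    (.seq (.add 2 2 3) (.add 2 2 3))))))))))

def decoderMachine : RAMProgram := .seq prologue (decodeProg.compile 0)

/-- Both products are computed by repeated addition; register `9`, never written here, supplies the
zero needed to copy `q` into the counter. -/
theorem exec_prologue (input : List ℕ) {n q : ℕ} (hn : input.getD 0 0 = n)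
    (hq : (n + 1) * (n + 1) = q) : ∃ u τ, RAMExec prologue (RAMState.initial input) u τ ∧
      τ ≤ 20 * (q + 1) ∧ u.reg 0 = q ∧ u.reg 2 = 2 + (q * q + q * q) + q ∧
      u.mem = fun a => input.getD a 0 := by
  set s := RAMState.initial input with hs
  have hreg : ∀ r, s.reg r = 0 := fun r => rfl
  have hmem : ∀ a, s.mem a = input.getD a 0 := fun a => rfl
  obtain ⟨u, k1, k2, k3, k4⟩ := RAMExec.mul_loop (x := 0) (y := 5) (c := 7) (o := 3) (by decide)
    (by decide) (by decide) (by decide) (by decide) (n + 1)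
    ((((s.setReg 1 n).setReg 3 1).setReg 5 (n + 1)).setReg 7 (n + 1)) (by simp) (by simp)
  have hu0 : u.reg 0 = q := by rw [k3]; simp [hreg, hq]
  have hu1 : ∀ r, r ≠ 0 → r ≠ 7 → u.reg r = ((((s.setReg 1 n).setReg 3 1).setReg 5
    (n + 1)).setReg 7 (n + 1)).reg r := k4
  obtain ⟨v, l1, l2, l3, l4⟩ := RAMExec.mul_loop (x := 2) (y := 0) (c := 7) (o := 3) (by decide)
    (by decide) (by decide) (by decide) (by decide) q
    (u.setReg 7 q) (by simp) (by simp [hu1])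
  have hv0 : v.reg 0 = q := by rw [l4 _ (by decide) (by decide)]; simp [hu0]
  have hv3 : v.reg 3 = 1 := by rw [l4 _ (by decide) (by decide)]; simp [hu1]
  have hv2 : v.reg 2 = q * q := by rw [l3]; simp [hu1, hreg, hu0]
  refine ⟨_, 1 + (1 + (1 + (1 + ((3 * (n + 1) + 1) + (1 + ((3 * q + 1) + (1 + (1 + (1 + 1))))))))),
    .seq (.load _ _ _) (.seq (.const _ _ _) (.seq (.add _ _ _ _) (.seq (.add _ _ _ _)
    (.seq (u := u) ?_ (.seq (.add _ _ _ _) (.seq (u := v) ?_ (.seq (.add _ _ _ _)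
    (.seq (.add _ _ _ _) (.seq (.add _ _ _ _) (.add _ _ _ _)))))))))), ?_, ?_, ?_, ?_⟩
  · convert k1 using 1
    rw [List.getD_eq_getElem?_getD] at hn
    simp [hreg, hmem, hn]
  · convert l1 using 1
    simp [hu0, hu1, hreg]
  · nlinarith
  · simp [hv0]
  · simp [hv2, hv0, hv3]; ring
  · funext a
    simp [l2, k2, hmem]

section

variable {F : Type} {q t : ℕ}

/-- The letter of a word with a given index. -/
def flatLetter (z : Word t F) (a : Fin (codeLen t * foldParam t)) : F := z a.divNat a.modNat

theorem flatLetter_finProdFinEquiv (z : Word t F) (i : Fin (codeLen t)) (j : Fin (foldParam t)) :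
    flatLetter z (finProdFinEquiv (i, j)) = z i j := by
  have h := finProdFinEquiv.symm_apply_apply (i, j)
  rw [finProdFinEquiv_symm_apply, Prod.mk.injEq] at h
  rw [flatLetter, h.1, h.2]

theorem codeLen_add_one (t : ℕ) : codeLen t + 1 = 2 ^ t := by
  have : 0 < 2 ^ t := by positivity
  unfold codeLen; omega

theorem codeLen_mul_foldParam_add_one (t : ℕ) :
    codeLen t * foldParam t + 1 = 2 ^ (2 * t) := by
  have h := rsLen_eq t
  have : 0 < 2 ^ (2 * t) := by positivity
  unfold rsLen at h; omega

theorem getD_tableList (ν : F ≃ Fin q) (op : F → F → F) (x y : F) :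
    (tableList ν op).getD (ν x * q + ν y) 0 = ν (op x y) := by
  have hlt := mul_add_lt_mul_self (ν x) (ν y)
  have hq : 0 < q := (ν x).pos
  have h1 : ((⟨ν x * q + ν y, hlt⟩ : Fin (q * q)).divNat) = ν x := by
    apply Fin.ext
    change ((ν x : ℕ) * q + ν y) / q = ν x
    rw [add_comm, Nat.add_mul_div_right _ _ hq, Nat.div_eq_of_lt (ν y).2, zero_add]
  have h2 : ((⟨ν x * q + ν y, hlt⟩ : Fin (q * q)).modNat) = ν y := by
    apply Fin.ext
    change ((ν x : ℕ) * q + ν y) % q = ν y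
    rw [add_comm, Nat.add_mul_mod_self_right, Nat.mod_eq_of_lt (ν y).2]
  rw [List.getD_eq_getElem _ _ (by simpa [tableList] using hlt)]
  simp only [tableList, List.getElem_ofFn, h1, h2, Equiv.symm_apply_apply]

theorem length_tableList (ν : F ≃ Fin q) (op : F → F → F) : (tableList ν op).length = q * q := by
  simp [tableList]

theorem length_wordList (ν : F ≃ Fin q) (z : Word t F) :
    (wordList ν z).length = codeLen t * foldParam t := by
  simp [wordList]

theorem getElem_wordList (ν : F ≃ Fin q) (z : Word t F) (a : ℕ) (h : a < (wordList ν z).length) :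
    (wordList ν z)[a] = ν (flatLetter z ⟨a, by simpa [wordList] using h⟩) := by
  simp [wordList, flatLetter]

/-- The letters of a word, extended by one letter that belongs to the number `0`. -/
def paddedWord (ν : F ≃ Fin q) (z : Word t F) (i : Fin q) : F :=
  if h : (i : ℕ) < codeLen t * foldParam t then flatLetter z ⟨i, h⟩ else ν.symm ⟨0, i.pos⟩

/-- The compiled program has cost polynomial in `q = (n + 1) ^ 2`, hence in `n`. The constants come
from the program alone and serve all fields. -/
theorem decoderMachine_outputs : ∃ A B : ℕ, ∀ (t q : ℕ) (hq : q = 2 ^ (2 * t)) (F : Type)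
    [Field F] [CharP F 2] (ν : F ≃ Fin q) (γ : Fˣ) (z : Word t F), ∃ x : Fin q → F,
      decoderMachine.OutputsWithin (A * codeLen t ^ B) (decoderInput ν γ z)
        (wordList ν (fun i j => x (Fin.castLE (by have := codeLen_mul_foldParam_add_one t; omega)
          (finProdFinEquiv (i, j))) : Word t F)) ∧
      ∀ i, IsDecodedLetter (γ : F) (paddedWord ν z) i (x i) := by
  obtain ⟨C, D, hCD⟩ := decodeProg.exists_cost_le
  refine ⟨(20 + C) * 5 ^ (D + 1), 2 * (D + 1), fun t q hq F _ _ ν γ z => ?_⟩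
  set n := codeLen t with hn
  have hnq : (n + 1) * (n + 1) = q := by rw [hn, codeLen_add_one, hq, ← pow_add]; congr 1; ring
  have hN := codeLen_mul_foldParam_add_one t
  rw [← hq] at hN
  set input := decoderInput ν γ z with hinput
  obtain ⟨s, τ, hs, hτ, h0, h2, hmem⟩ := exec_prologue input (n := n) rfl hnq
  -- The base lies one cell above the end of the input, whose word has only `q - 1` letters. The
  -- extra cell holds `0`, which is the padding letter. The initial variables and arrays are
  -- whatever the machine happens to contain.
  let e : ArrEnv := ⟨q, 2 + (q * q + q * q) + q, fun x => s.reg (varReg x), s.mem,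
    fun k i => s.mem (2 + (q * q + q * q) + q + (8 * i + k))⟩
  have he : e.RepresentedBy s := ⟨h0, h2, fun _ => rfl, fun _ _ => rfl, fun _ _ => rfl⟩
  have hin : ∀ a, e.inp a = input.getD a 0 := fun a => congrFun hmem a
  have hlen1 : ([codeLen t, (ν (γ : F) : ℕ)] : List ℕ).length = 2 := rfl
  have hinp : e.HasInput ν (γ : F) (paddedWord ν z) := by
    have hlt := fun x y : F => mul_add_lt_mul_self (ν x) (ν y)
    refine ⟨⟨rfl, by simp only [e]; omega, fun x y => ?_, fun x y => ?_⟩, le_rfl, ?_, fun i => ?_⟩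
    · rw [hin, hinput, decoderInput, List.getD_append _ _ _ _ (by
        simp only [List.length_append, length_tableList, hlen1]; have := hlt x y; omega),
        List.getD_append _ _ _ _ (by
        simp only [List.length_append, length_tableList, hlen1]; have := hlt x y; omega),
        List.getD_append_right _ _ _ _ (by simp only [hlen1]; omega), hlen1, Nat.add_sub_cancel_left,
        getD_tableList]
    · rw [hin, hinput, decoderInput, List.getD_append _ _ _ _ (by
        simp only [List.length_append, length_tableList, hlen1]; have := hlt x y; omega),
        List.getD_append_right _ _ _ _ (by
          simp only [List.length_append, length_tableList, hlen1]; omega)]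
      simp only [List.length_append, length_tableList, hlen1]
      rw [Nat.add_sub_cancel_left, getD_tableList]
    · rw [hin]; rfl
    · rw [hin, hinput, decoderInput, List.getD_append_right _ _ _ _ (by
          simp only [List.length_append, length_tableList, hlen1]; omega)]
      simp only [List.length_append, length_tableList, hlen1]
      rw [show 2 + (q * q + q * q) + (i : ℕ) - (2 + q * q + q * q) = i by omega, paddedWord]
      split_ifs with hi
      · rw [List.getD_eq_getElem _ _ (by rwa [length_wordList]), getElem_wordList]
      · rw [List.getD_eq_default _ _ (by rw [length_wordList]; omega)]
        simp
  obtain ⟨u, σ, hu, hσ, hrep, -⟩ := decodeProg.exec_compile e 0 s he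
  obtain ⟨x, hx⟩ := run_decodeProg γ.ne_zero hinp
  refine ⟨x, ⟨u, _, .seq hs hu, ?_, fun a ha => ?_⟩, fun i => (hx i).2⟩
  -- For `n = 0` the field would have a single element; a bound of the form `A * n ^ B` needs `n ≥
  -- 1`.
  · have hn1 : 1 ≤ n := by
      by_contra hc
      have h1 : q = 1 := by rw [← hnq]; simp [show n = 0 by omega]
      have h2 : ν 0 = ν 1 := by
        have h3 : ∀ i j : Fin q, i = j := fun i j => Fin.ext (by omega)
        exact h3 _ _
      exact zero_ne_one (ν.injective h2)
    have hq1 : q + 1 ≤ 5 * n ^ 2 := by nlinarith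
    have hcost := hCD q
    have h4 : C * (q + 1) ^ D ≤ C * (q + 1) ^ (D + 1) :=
      Nat.mul_le_mul_left _ (Nat.pow_le_pow_right (by omega) (by omega))
    have h5 : 20 * (q + 1) ≤ 20 * (q + 1) ^ (D + 1) :=
      Nat.mul_le_mul_left _ (Nat.le_self_pow (by omega) _)
    calc τ + σ ≤ (20 + C) * (q + 1) ^ (D + 1) := by
          rw [add_mul]
          have : e.size = q := rfl
          rw [this] at hσ
          omega
      _ ≤ (20 + C) * (5 * n ^ 2) ^ (D + 1) :=
          Nat.mul_le_mul_left _ (Nat.pow_le_pow_left hq1 _)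
      _ = (20 + C) * 5 ^ (D + 1) * n ^ (2 * (D + 1)) := by rw [mul_pow, ← pow_mul]; ring
  · rw [length_wordList] at ha
    have haq : a < q := by omega
    rw [hrep.inp a (by rw [ArrStmt.run_base]; simp only [e]; omega), (hx ⟨a, haq⟩).1,
      getElem_wordList, flatLetter]
    have h := finProdFinEquiv.apply_symm_apply (⟨a, ha⟩ : Fin (codeLen t * foldParam t))
    rw [finProdFinEquiv_symm_apply] at h
    rw [h]
    rfl

end

/-! ### Correctness of the decoder -/

section

variable {F : Type} [Field F] {q : ℕ} {γ : F}

/-- The first `T.card` columns of these rows form a Vandermonde matrix with distinct nodes `γ ^ i`;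
`hcard` says that none of these columns is truncated to zero. -/
theorem linearIndependent_pointMatrix_row (hγ : ∀ i j, i + 1 < q → j + 1 < q → γ ^ i = γ ^ j → i = j)
    {T : Finset (Fin q)} (hT : ∀ i ∈ T, (i : ℕ) + 1 < q) (hcard : ∀ a < T.card, 20 * a < q) :
    LinearIndependent F fun i : T => (pointMatrix q γ).row i := by
  rw [Fintype.linearIndependent_iff]
  intro c hc
  let f : Fin T.card ≃ T := T.equivFin.symm
  have hinj : Function.Injective fun k : Fin T.card => γ ^ ((f k : Fin q) : ℕ) := by
    intro k l hkl
    have := hγ _ _ (hT _ (f k).2) (hT _ (f l).2) hkl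
    exact f.injective (Subtype.ext (Fin.ext this))
  have hsum : ∀ k : Fin T.card, ∑ l, c (f l) * (γ ^ ((f l : Fin q) : ℕ)) ^ (k : ℕ) = 0 := by
    intro k
    have hk : (k : ℕ) < q := by
      have := T.card_le_univ
      rw [Fintype.card_fin] at this
      omega
    have h := congrFun hc ⟨k, hk⟩
    rw [Finset.sum_apply, ← f.sum_comp] at h
    rw [← Pi.zero_apply (M := fun _ => F) (⟨k, hk⟩ : Fin q), ← h]
    refine Finset.sum_congr rfl fun l _ => ?_
    simp only [Pi.smul_apply, smul_eq_mul, Matrix.row_apply, pointMatrix, Matrix.of_apply]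
    rw [if_pos ⟨hT _ (f l).2, hcard k k.2⟩, pow_mul]
  have h0 := Matrix.eq_zero_of_forall_pow_sum_mul_pow_eq_zero hinj hsum
  intro i
  have := congrFun h0 (f.symm i)
  simpa using this

open Classical in
-- The matrix is `Bᵀ D B`, where `B` consists of the independent point rows of the support and `D`
-- is diagonal and invertible. Independence makes its kernel equal to that of `B`. The form of
-- `hcard` leaves room for one error more than `20 * card < q` would, as needed when a correct
-- letter is spoiled.
theorem rank_syndromeMatrix (hγ : ∀ i j, i + 1 < q → j + 1 < q → γ ^ i = γ ^ j → i = j)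
    (w : Fin q → F) (hT : ∀ i, w i ≠ 0 → (i : ℕ) + 1 < q)
    (hcard : ∀ a < (Finset.univ.filter fun i => w i ≠ 0).card, 20 * a < q) :
    (syndromeMatrix γ w).rank = (Finset.univ.filter fun i => w i ≠ 0).card := by
  set T := Finset.univ.filter fun i => w i ≠ 0 with hTdef
  have hmem : ∀ i, i ∈ T ↔ w i ≠ 0 := fun i => by simp [hTdef]
  have hli := linearIndependent_pointMatrix_row hγ (fun i hi => hT i ((hmem i).1 hi)) hcard
  let B : Matrix T (Fin q) F := Matrix.of fun i : T => (pointMatrix q γ).row i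
  have hB : B.rank = T.card := by
    rw [LinearIndependent.rank_matrix (M := B) hli, Fintype.card_coe]
  have hker : LinearMap.ker (syndromeMatrix γ w).mulVecLin = LinearMap.ker B.mulVecLin := by
    have hformula : ∀ x, (syndromeMatrix γ w).mulVec x =
        ∑ i : T, (w i * B.mulVec x i) • (pointMatrix q γ).row i := by
      intro x
      ext a
      rw [Finset.sum_apply]
      refine Eq.trans ?_ (Finset.sum_coe_sort T
        (fun i => (w i * ∑ b, pointMatrix q γ i b * x b) * pointMatrix q γ i a)).symm
      rw [Finset.sum_subset (Finset.subset_univ T)]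
      · simp only [Matrix.mulVec, dotProduct, syndromeMatrix, Matrix.of_apply, Finset.sum_mul,
          Finset.mul_sum]
        rw [Finset.sum_comm]
        exact Finset.sum_congr rfl fun i _ => Finset.sum_congr rfl fun b _ => by ring
      · intro i _ hi
        have : w i = 0 := by simpa [hmem] using hi
        simp [this]
    ext x
    rw [LinearMap.mem_ker, LinearMap.mem_ker, Matrix.mulVecLin_apply, Matrix.mulVecLin_apply,
      hformula]
    constructor
    · intro h
      ext i
      have := (Fintype.linearIndependent_iff.1 hli) _ h i
      exact (mul_eq_zero.1 this).resolve_left ((hmem i).1 i.2)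
    · intro h
      simp [h]
  have h1 := LinearMap.finrank_range_add_finrank_ker (syndromeMatrix γ w).mulVecLin
  have h2 := LinearMap.finrank_range_add_finrank_ker B.mulVecLin
  rw [hker] at h1
  rw [← hB]
  change (syndromeMatrix γ w).rank + _ = _ at h1
  change B.rank + _ = _ at h2
  omega

/-- Syndromes are linear in the word, so a change of a received letter acts on the syndromes as the
same change of the unknown error. -/
theorem modifiedMatrix_eq [DecidableEq (Fin q)] (z e : Fin q → F)
    (h : syndromeMatrix γ z = syndromeMatrix γ e) (i : Fin q) (v : F) :
    modifiedMatrix γ z i v = syndromeMatrix γ (Function.update e i (e i + v)) := by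
  ext a b
  rw [modifiedMatrix, Matrix.of_apply, h, syndromeMatrix, syndromeMatrix, Matrix.of_apply,
    Matrix.of_apply, ← Finset.add_sum_erase _ _ (Finset.mem_univ i),
    ← Finset.add_sum_erase (a := i) _ _ (Finset.mem_univ i)]
  have hsum : ∑ j ∈ Finset.univ.erase i, Function.update e i (e i + v) j *
      (pointMatrix q γ j a * pointMatrix q γ j b) =
      ∑ j ∈ Finset.univ.erase i, e j * (pointMatrix q γ j a * pointMatrix q γ j b) :=
    Finset.sum_congr rfl fun j hj => by rw [Function.update_of_ne (Finset.ne_of_mem_erase hj)]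
  rw [Function.update_self, hsum]
  ring

open Classical in
/-- If the number of errors `e` is at most `q / 20` then the decoder finds the letter `x`. -/
theorem IsDecodedLetter.eq_sub [CharP F 2]
    (hγ : ∀ i j, i + 1 < q → j + 1 < q → γ ^ i = γ ^ j → i = j) {z e : Fin q → F}
    (he : ∀ i, e i ≠ 0 → (i : ℕ) + 1 < q)
    (hcard : 20 * (Finset.univ.filter fun i => e i ≠ 0).card < q)
    (hsyn : syndromeMatrix γ z = syndromeMatrix γ e) {i : Fin q} (hi : (i : ℕ) + 1 < q) {d : F}
    (hd : IsDecodedLetter γ z i d) : d = z i + e i := by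
  have hr := rank_syndromeMatrix hγ e he (fun a ha => by omega)
  set T := Finset.univ.filter fun i => e i ≠ 0 with hT
  rw [← hsyn] at hr
  -- The modified error has support `T` without `i` or with `i`, according to whether `v` cancels `e
  -- i`; the rank is the size of this support.
  have hmod : ∀ v, (modifiedMatrix γ z i v).rank =
      if e i + v = 0 then (T.erase i).card else (insert i T).card := by
    intro v
    have hsupp : (Finset.univ.filter fun j => Function.update e i (e i + v) j ≠ 0) =
        if e i + v = 0 then T.erase i else insert i T := by
      ext j
      by_cases hj : j = i
      · subst hj
        split_ifs with h <;> simp [h]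
      · split_ifs with h <;> simp [hj, hT]
    have hle : (Finset.univ.filter fun j => Function.update e i (e i + v) j ≠ 0).card ≤
        T.card + 1 := by
      rw [hsupp]
      split_ifs
      · exact (Finset.card_erase_le).trans (by omega)
      · exact Finset.card_insert_le _ _
    rw [modifiedMatrix_eq z e hsyn, rank_syndromeMatrix hγ _ _ (fun a ha => by omega), hsupp]
    · split_ifs <;> rfl
    · intro j hj
      by_cases hji : j = i
      · rwa [hji]
      · rw [Function.update_of_ne hji] at hj
        exact he j hj
  have hlt : ∀ v, (modifiedMatrix γ z i v).rank < (syndromeMatrix γ z).rank ↔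
      e i + v = 0 ∧ e i ≠ 0 := by
    intro v
    rw [hmod, hr]
    have hmem : i ∈ T ↔ e i ≠ 0 := by simp [hT]
    split_ifs with h
    · by_cases hi : i ∈ T
      · have := Finset.card_pos.2 ⟨i, hi⟩
        rw [Finset.card_erase_of_mem hi]
        simp only [h, true_and, ← hmem, hi, iff_true]
        omega
      · rw [Finset.erase_eq_of_notMem hi]
        simp only [← hmem, hi, and_false, lt_irrefl]
    · have := Finset.card_le_card (Finset.subset_insert i T)
      simp only [h, false_and, iff_false]
      omega
  rcases hd with ⟨v, hv, rfl⟩ | ⟨hv, rfl⟩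
  · rw [CharTwo.add_eq_zero.1 ((hlt v).1 hv).1]
  · have h := hv (e i)
    rw [hlt, CharTwo.add_self_eq_zero] at h
    have : e i = 0 := by simpa using h
    rw [this, add_zero]

end

/-! ### From letterwise decoding to the dual code -/

section

variable {F : Type} [Field F] {t q : ℕ}

/-- These are the parity checks given by the codewords of the monomials `X ^ d`. -/
theorem sum_flatLetter_mul_pow_eq_zero {γ : Fˣ} {x : Word t F} (hx : x ∈ dualCode (frsCode t γ))
    {d : ℕ} (hd : d ≤ rsLen t / 10) :
    ∑ a : Fin (codeLen t * foldParam t), flatLetter x a * (γ : F) ^ ((a : ℕ) * d) = 0 := by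
  have h := hx (foldWord fun a : Fin (codeLen t * foldParam t) => (γ : F) ^ ((a : ℕ) * d))
    ⟨_, ⟨Polynomial.X ^ d, by simpa using hd, fun a => by simp [pow_mul]⟩, rfl⟩
  rw [← h, ← Fintype.sum_prod_type', ← finProdFinEquiv.sum_comp]
  refine Finset.sum_congr rfl fun p _ => ?_
  rw [flatLetter_finProdFinEquiv]
  rfl

/-- The letters of a word, extended by one letter zero. -/
def zeroPadded (q : ℕ) (z : Word t F) (i : Fin q) : F :=
  if h : (i : ℕ) < codeLen t * foldParam t then flatLetter z ⟨i, h⟩ else 0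

/-- The last row of the point matrix is zero, so the padding letter has no influence. -/
theorem syndromeMatrix_congr {γ : F} {z z' : Fin q → F}
    (h : ∀ i : Fin q, (i : ℕ) + 1 < q → z i = z' i) :
    syndromeMatrix γ z = syndromeMatrix γ z' := by
  ext a b
  simp only [syndromeMatrix, Matrix.of_apply]
  refine Finset.sum_congr rfl fun i _ => ?_
  by_cases hi : (i : ℕ) + 1 < q
  · rw [h i hi]
  · simp [pointMatrix, hi]

theorem syndromeMatrix_add (γ : F) (z z' : Fin q → F) :
    syndromeMatrix γ (z + z') = syndromeMatrix γ z + syndromeMatrix γ z' := by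
  ext a b
  simp [syndromeMatrix, add_mul, Finset.sum_add_distrib]

theorem syndromeMatrix_dual (hq : q = 2 ^ (2 * t)) {γ : Fˣ} {x : Word t F}
    (hx : x ∈ dualCode (frsCode t γ)) :
    syndromeMatrix (γ : F) (zeroPadded q x) = 0 := by
  have hN := codeLen_mul_foldParam_add_one t
  rw [← hq] at hN
  ext a b
  simp only [syndromeMatrix, Matrix.of_apply, Matrix.zero_apply]
  by_cases hab : 20 * (a : ℕ) < q ∧ 20 * (b : ℕ) < q
  swap
  · refine Finset.sum_eq_zero fun i _ => ?_
    by_cases ha : 20 * (a : ℕ) < q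
    · have hb : ¬ 20 * (b : ℕ) < q := fun hb => hab ⟨ha, hb⟩
      simp [pointMatrix, hb]
    · simp [pointMatrix, ha]
  -- From `20 a < q` and `20 b < q` follows `10 (a + b) ≤ q - 1 = N`; this is why the exponents are
  -- truncated at `q / 20`.
  have key := sum_flatLetter_mul_pow_eq_zero hx (d := a + b) (by unfold rsLen; omega)
  rw [← key]
  subst hN
  rw [Fin.sum_univ_castSucc]
  have hlast : zeroPadded (codeLen t * foldParam t + 1) x (Fin.last _) = 0 := by
    simp [zeroPadded]
  rw [hlast, zero_mul, add_zero]
  refine Finset.sum_congr rfl fun i _ => ?_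
  have h1 : zeroPadded (codeLen t * foldParam t + 1) x i.castSucc = flatLetter x i := by
    simp [zeroPadded]
  rw [h1, pointMatrix, Matrix.of_apply, Matrix.of_apply, if_pos ⟨by simp, hab.1⟩,
    if_pos ⟨by simp, hab.2⟩, ← pow_add, mul_add]
  simp

open Classical in
theorem card_zeroPadded_ne_zero_le (hq : codeLen t * foldParam t ≤ q) (e : Word t F) :
    (Finset.univ.filter fun i => zeroPadded q e i ≠ 0).card ≤
      (Finset.univ.filter fun i => e i ≠ 0).card * foldParam t := by
  calc _ ≤ (((Finset.univ.filter fun i => e i ≠ 0) ×ˢ Finset.univ).image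
      fun p : Fin (codeLen t) × Fin (foldParam t) => Fin.castLE hq (finProdFinEquiv p)).card := by
        refine Finset.card_le_card fun i hi => ?_
        rw [Finset.mem_filter, zeroPadded] at hi
        by_cases h : (i : ℕ) < codeLen t * foldParam t
        · rw [dif_pos h] at hi
          refine Finset.mem_image.2 ⟨finProdFinEquiv.symm ⟨i, h⟩, ?_, ?_⟩
          · simp only [Finset.mem_product, Finset.mem_filter, Finset.mem_univ, true_and, and_true,
              finProdFinEquiv_symm_apply]
            intro h0
            exact hi.2 (by rw [flatLetter, h0]; rfl)
          · rw [Equiv.apply_symm_apply]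
            rfl
        · simp [dif_neg h] at hi
    _ ≤ _ := Finset.card_image_le
    _ = _ := by rw [Finset.card_product, Finset.card_univ, Fintype.card_fin]

open Classical in
-- At most `n / 20` wrong symbols give at most `n m / 20 < q / 20` wrong letters, and then the
-- decoder returns `(x + e) + e = x` letter by letter.
theorem decoded_eq [CharP F 2] (hq : q = 2 ^ (2 * t)) (ν : F ≃ Fin q) {γ : Fˣ}
    (hγ : ∀ i j, i + 1 < q → j + 1 < q → (γ : F) ^ i = (γ : F) ^ j → i = j)
    {x e : Word t F} (hx : x ∈ dualCode (frsCode t γ))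
    (he : 20 * (Finset.univ.filter fun i => e i ≠ 0).card ≤ codeLen t) {d : Fin q → F}
    (hd : ∀ i, IsDecodedLetter (γ : F) (paddedWord ν (x + e)) i (d i)) (i : Fin (codeLen t))
    (j : Fin (foldParam t)) (hle : codeLen t * foldParam t ≤ q) :
    d (Fin.castLE hle (finProdFinEquiv (i, j))) = x i j := by
  have hN := codeLen_mul_foldParam_add_one t
  rw [← hq] at hN
  have hpad : ∀ k : Fin q, (k : ℕ) + 1 < q →
      paddedWord ν (x + e) k = (zeroPadded q x + zeroPadded q e) k := by
    intro k hk
    have hk' : (k : ℕ) < codeLen t * foldParam t := by omega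
    simp [paddedWord, zeroPadded, hk', flatLetter]
  set k := Fin.castLE hle (finProdFinEquiv (i, j)) with hk
  have hkq : (k : ℕ) + 1 < q := by
    have := (finProdFinEquiv (i, j)).2
    simp only [hk, Fin.val_castLE]
    omega
  have hval : zeroPadded q x k = x i j := by
    have := (finProdFinEquiv (i, j)).2
    rw [zeroPadded, dif_pos (by rw [hk, Fin.val_castLE]; exact this)]
    exact flatLetter_finProdFinEquiv x i j
  have hcard : 20 * (Finset.univ.filter fun i => zeroPadded q e i ≠ 0).card < q := by
    have h1 := card_zeroPadded_ne_zero_le hle e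
    have h2 := Nat.mul_le_mul_right (foldParam t) he
    rw [mul_assoc] at h2
    omega
  have := (hd k).eq_sub hγ (e := zeroPadded q e) (fun l hl => ?_) hcard ?_ hkq
  · rw [this, hpad k hkq, Pi.add_apply, hval, add_assoc, CharTwo.add_self_eq_zero, add_zero]
  · by_contra hlq
    apply hl
    rw [zeroPadded, dif_neg (by omega)]
  · rw [syndromeMatrix_congr hpad, syndromeMatrix_add, syndromeMatrix_dual hq hx, zero_add]

end

/-! ### The error distribution -/

theorem sum_symbolProb_mul {F : Type} [Field F] [Fintype F] {m : ℕ} (hm : 0 < m) (p lam : ℝ)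
    (h : (Fin m → F) → ℝ) (h0 : h 0 = 1) (h1 : ∀ s, s ≠ 0 → h s = lam) :
    ∑ s : Fin m → F, symbolProb p s * h s = 1 - p + p * lam := by
  classical
  have hcard : (1 : ℝ) < Fintype.card (Fin m → F) := by
    have : Nonempty (Fin m) := ⟨⟨0, hm⟩⟩
    exact_mod_cast Fintype.one_lt_card
  rw [← Finset.add_sum_erase _ _ (Finset.mem_univ (0 : Fin m → F)),
    Finset.sum_congr (g := fun _ => p / ((Fintype.card (Fin m → F) : ℝ) - 1) * lam) rfl
    fun s hs => by rw [symbolProb, if_neg (Finset.ne_of_mem_erase hs), h1 s (Finset.ne_of_mem_erase hs)]]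
  rw [Finset.sum_const, Finset.card_erase_of_mem (Finset.mem_univ _), Finset.card_univ, nsmul_eq_mul,
    Nat.cast_sub Fintype.card_pos, symbolProb, if_pos rfl, h0]
  have : (Fintype.card (Fin m → F) : ℝ) - 1 ≠ 0 := by linarith
  push_cast at this ⊢
  field_simp

open Classical in
-- This is the generating function of the number of wrong symbols, a sum of independent Bernoulli
-- variables. At `lam = 1` it gives total mass one.
theorem sum_prod_symbolProb_mul_pow {F : Type} [Field F] [Fintype F] {n m : ℕ} (hm : 0 < m)
    (p lam : ℝ) :
    ∑ e : Fin n → Fin m → F, (∏ i, symbolProb p (e i)) *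
      lam ^ (Finset.univ.filter fun i => e i ≠ 0).card = (1 - p + p * lam) ^ n := by
  have h := Fintype.sum_pow (fun s : Fin m → F => symbolProb p s * if s ≠ 0 then lam else 1) n
  rw [sum_symbolProb_mul hm p lam _ (by simp) (fun s hs => by simp [hs])] at h
  rw [h]
  refine Finset.sum_congr rfl fun e _ => ?_
  rw [Finset.prod_mul_distrib, Finset.prod_ite, Finset.prod_const, Finset.prod_const_one, mul_one]

open Classical in
/-- A Chernoff bound: with at most `n / 20` wrong symbols, up to an exponentially small
probability, an event that contains all such errors is almost certain. -/
theorem exists_le_errorProb : ∃ c : ℝ, 0 < c ∧ ∀ (F : Type) [Field F] [Fintype F] (n m : ℕ)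
    (p : ℝ) (E : Set (Fin n → Fin m → F)), 0 < m → 0 ≤ p → p ≤ 0.04 →
    (∀ e : Fin n → Fin m → F, 20 * (Finset.univ.filter fun i => e i ≠ 0).card ≤ n → e ∈ E) →
    1 - (2 : ℝ) ^ (-(c * (n : ℝ))) ≤ errorProb p E := by
  -- Markov's inequality is applied to `(5/4) ^ weight`, with mean `(1 + p/4) ^ n ≤ 1.01 ^ n`. A
  -- weight above `n / 20` makes this variable at least `μ ^ n`, and `1.01 ^ 20 < 5/4` gives
  -- exponential decay.
  obtain ⟨μ, hμ0, hμ⟩ : ∃ μ : ℝ, 0 ≤ μ ∧ μ ^ 20 = 5 / 4 :=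
    ⟨(5 / 4 : ℝ) ^ ((20 : ℕ) : ℝ)⁻¹, by positivity, Real.rpow_inv_natCast_pow (by norm_num) (by norm_num)⟩
  have hμ1 : 1.01 < μ := by
    refine lt_of_pow_lt_pow_left₀ 20 hμ0 ?_
    rw [hμ]; norm_num
  have hμpos : 0 < μ := by linarith
  refine ⟨Real.logb 2 (μ / 1.01), Real.logb_pos (by norm_num) (by rw [lt_div_iff₀ (by norm_num)]; linarith),
    fun F _ _ n m p E hm hp0 hp hE => ?_⟩
  set w : (Fin n → Fin m → F) → ℝ := fun e => ∏ i, symbolProb p (e i) with hw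
  have hw0 : ∀ e, 0 ≤ w e := fun e => by
    refine Finset.prod_nonneg fun i _ => ?_
    have : Nonempty (Fin m) := ⟨⟨0, hm⟩⟩
    have hcard : (1 : ℝ) < Fintype.card (Fin m → F) := by exact_mod_cast Fintype.one_lt_card
    unfold symbolProb
    split_ifs
    · linarith
    · exact div_nonneg hp0 (by linarith)
  have htotal : ∑ e, w e = 1 := by
    have := sum_prod_symbolProb_mul_pow (F := F) (n := n) hm p 1
    simpa [hw] using this
  have hpow : (2 : ℝ) ^ (-(Real.logb 2 (μ / 1.01) * (n : ℝ))) = (1.01 / μ) ^ n := by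
    rw [← mul_neg, Real.rpow_mul (by norm_num), Real.rpow_logb (by norm_num) (by norm_num)
      (by positivity), Real.rpow_neg (by positivity), Real.rpow_natCast, ← inv_pow, inv_div]
  have hbad : ∑ e, (if e ∈ E then 0 else w e) ≤ (1.01 / μ) ^ n := by
    rw [div_pow, le_div_iff₀ (by positivity), Finset.sum_mul]
    calc ∑ e, (if e ∈ E then 0 else w e) * μ ^ n
        ≤ ∑ e, w e * (5 / 4) ^ (Finset.univ.filter fun i => e i ≠ 0).card := by
          refine Finset.sum_le_sum fun e _ => ?_
          split_ifs with he
          · rw [zero_mul]; exact mul_nonneg (hw0 e) (by positivity)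
          · refine mul_le_mul_of_nonneg_left ?_ (hw0 e)
            rw [← hμ, ← pow_mul]
            refine pow_le_pow_right₀ (by linarith) ?_
            by_contra hc
            exact he (hE e (by omega))
      _ = (1 - p + p * (5 / 4)) ^ n := sum_prod_symbolProb_mul_pow hm p _
      _ ≤ 1.01 ^ n := by
          refine pow_le_pow_left₀ (by linarith) ?_ n
          norm_num at hp ⊢
          linarith
  have hsplit : errorProb p E + ∑ e, (if e ∈ E then 0 else w e) = 1 := by
    rw [← htotal, errorProb, ← Finset.sum_add_distrib]
    refine Finset.sum_congr rfl fun e _ => ?_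
    split_ifs <;> simp [hw]
  rw [hpow]
  linarith

/-! ### Unique decodability of the dual code -/

theorem charP_two_of_card {F : Type} [Field F] [Fintype F] {k : ℕ}
    (h : Fintype.card F = 2 ^ k) : CharP F 2 := by
  obtain ⟨p, hp⟩ := CharP.exists F
  obtain ⟨n, hprime, hcard⟩ := FiniteField.card F p
  have hdvd : p ∣ 2 ^ k := by
    rw [← h, hcard]
    exact dvd_pow_self p n.ne_zero
  rw [← (Nat.prime_dvd_prime_iff_eq hprime Nat.prime_two).1 (hprime.dvd_of_dvd_pow hdvd)]
  exact hp

theorem pow_inj_of_generator {F : Type} [Field F] [Fintype F] {γ : Fˣ}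
    (hγ : ∀ x : Fˣ, x ∈ Subgroup.zpowers γ) {i j : ℕ} (hi : i + 1 < Fintype.card F)
    (hj : j + 1 < Fintype.card F) (h : (γ : F) ^ i = (γ : F) ^ j) : i = j := by
  classical
  have hord : orderOf γ = Fintype.card F - 1 := by
    rw [orderOf_eq_card_of_forall_mem_zpowers hγ, Nat.card_eq_fintype_card, Fintype.card_units]
  refine pow_injOn_Iio_orderOf (x := γ) ?_ ?_ (Units.ext (by simpa using h))
  · rw [Set.mem_Iio, hord]; omega
  · rw [Set.mem_Iio, hord]; omega

theorem dual_uniquely_decodable :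
    ∃ (P : RAMProgram) (A B : ℕ) (c : ℝ) (t₀ : ℕ), 0 < c ∧
      ∀ (t : ℕ) (F : Type) [Field F] [Fintype F] (ν : F ≃ Fin (2 ^ (2 * t))) (γ : Fˣ),
        (∀ x : Fˣ, x ∈ Subgroup.zpowers γ) →
        ∃ Decode : Word t F → Word t F,
          (∀ z : Word t F, P.OutputsWithin (A * codeLen t ^ B)
            (decoderInput ν γ z) (wordList ν (Decode z))) ∧
          (t₀ ≤ t → ∀ p : ℝ, 0 ≤ p → p ≤ 0.04 →
            1 - (2 : ℝ) ^ (-(c * (codeLen t : ℝ))) ≤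
              errorProb p {e : Word t F | ∀ x ∈ dualCode (frsCode t γ), Decode (x + e) = x}) := by
  obtain ⟨c, hc, hprob⟩ := exists_le_errorProb
  obtain ⟨A, B, hAB⟩ := decoderMachine_outputs
  refine ⟨decoderMachine, A, B, c, 0, hc, fun t F _ _ ν γ hγ => ?_⟩
  have hcard : Fintype.card F = 2 ^ (2 * t) := by rw [Fintype.card_congr ν, Fintype.card_fin]
  have := charP_two_of_card hcard
  choose d hout hdec using hAB t _ rfl F ν γ
  refine ⟨_, hout, fun _ p hp0 hp => hprob F _ _ p _ (Nat.succ_pos _) hp0 hp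
    fun e he x hx => ?_⟩
  funext i j
  exact decoded_eq rfl ν (fun i j hi hj h => pow_inj_of_generator hγ (by rwa [hcard])
    (by rwa [hcard]) h) hx he (hdec (x + e)) i j _

/-! ### Interpolation with multiplicities -/

section

open Polynomial

/-- The exponents of the monomials of degree less than `w` in `s` variables. -/
noncomputable def exponentsBelow (s w : ℕ) : Finset (Fin s →₀ ℕ) :=
  (Finset.range w).biUnion fun j => Finset.univ.finsuppAntidiag j

theorem mem_exponentsBelow {s w : ℕ} {b : Fin s →₀ ℕ} :
    b ∈ exponentsBelow s w ↔ ∑ j, b j < w := by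
  simp [exponentsBelow, Finset.mem_finsuppAntidiag]

/-- Stars and bars in each degree, summed over the degrees up to `w`. -/
theorem card_exponentsBelow_succ (s w : ℕ) :
    (exponentsBelow s (w + 1)).card = (w + s).choose s := by
  rw [exponentsBelow, Finset.card_biUnion, ← Nat.sum_range_multichoose]
  · exact Finset.sum_congr rfl fun j _ => by
      rw [Finset.card_finsuppAntidiag_nat_eq_multichoose, Finset.card_univ, Fintype.card_fin]
  · intro i _ j _ hij
    rw [Function.onFun, Finset.disjoint_left]
    intro b hb hb'
    rw [Finset.mem_finsuppAntidiag] at hb hb'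
    exact hij (hb.1.symm.trans hb'.1)

theorem exponentsBelow_mono {s w w' : ℕ} (h : w ≤ w') : exponentsBelow s w ⊆ exponentsBelow s w' :=
  fun _ hb => mem_exponentsBelow.2 ((mem_exponentsBelow.1 hb).trans_le h)

section

variable {F : Type} [Field F] {s : ℕ}

/-- Substitution into a polynomial vanishes to order `r` if the low-order coefficients of the
polynomial vanish after translation to the point. -/
theorem X_sub_C_pow_dvd_aeval (Q : MvPolynomial (Fin s) F[X]) (r : ℕ) (x : F) (y : Fin s → F)
    (hQ : ∀ d ∈ exponentsBelow s r, ∀ i < r, (taylor x ((MvPolynomial.aeval (fun j =>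
      (MvPolynomial.X j + MvPolynomial.C (C (y j)) : MvPolynomial (Fin s) F[X])) Q).coeff d)).coeff i
        = 0)
    (g : Fin s → F[X]) (hg : ∀ j, (g j).eval x = y j) :
    (X - C x) ^ r ∣ MvPolynomial.aeval g Q := by
  set Q' := MvPolynomial.aeval (fun j =>
      (MvPolynomial.X j + MvPolynomial.C (C (y j)) : MvPolynomial (Fin s) F[X])) Q with hQ'
  -- Expand around `y`. In a term of total degree below `r` the coefficient is divisible by `(X - x)
  -- ^ r`; in any other term the product of the `g j - y j`, each divisible by `X - x`, already is.
  have h1 : MvPolynomial.aeval g Q = MvPolynomial.aeval (fun j => g j - C (y j)) Q' := by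
    rw [hQ', ← AlgHom.comp_apply]
    congr 1
    ext j : 1
    simp
  rw [h1, MvPolynomial.aeval_def, MvPolynomial.eval₂_eq']
  refine Finset.dvd_sum fun d _ => ?_
  by_cases hd : d ∈ exponentsBelow s r
  · refine Dvd.dvd.mul_right ?_ _
    rw [Algebra.algebraMap_self, RingHom.id_apply, X_sub_C_pow_dvd_iff, X_pow_dvd_iff]
    intro i hi
    rw [← taylor_apply]
    exact hQ d hd i hi
  · refine Dvd.dvd.mul_left ?_ _
    rw [mem_exponentsBelow, not_lt] at hd
    refine (pow_dvd_pow _ hd).trans ?_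
    rw [← Finset.prod_pow_eq_pow_sum]
    refine Finset.prod_dvd_prod_of_dvd _ _ fun j _ => pow_dvd_pow_of_dvd ?_ _
    rw [dvd_iff_isRoot]
    simp [hg]

/-- The vanishing conditions form a homogeneous linear system with fewer equations than unknowns.
Order `r` is imposed separately in `X` and in the total degree of the `Y`s; this costs more
equations than ordinary multiplicity but keeps the count simple. -/
theorem exists_interpolant {ι : Type} [Fintype ι] (x : ι → F) (y : ι → Fin s → F) (A w r : ℕ)
    (hcount : Fintype.card ι * ((r + s).choose s * r) < (w + s).choose s * A) :
    ∃ p : (Fin s →₀ ℕ) → F[X], (∃ b ∈ exponentsBelow s (w + 1), p b ≠ 0) ∧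
      (∀ b, (p b).degree < A) ∧ ∀ k (g : Fin s → F[X]), (∀ j, (g j).eval (x k) = y k j) →
        (X - C (x k)) ^ r ∣ ∑ b ∈ exponentsBelow s (w + 1), p b * ∏ j, g j ^ b j := by
  classical
  let p : (exponentsBelow s (w + 1) → degreeLT F A) →ₗ[F] MvPolynomial (Fin s) F[X] :=
    { toFun := fun c => ∑ b : exponentsBelow s (w + 1),
        MvPolynomial.monomial (b : Fin s →₀ ℕ) (c b : F[X])
      map_add' := fun c c' => by simp [Finset.sum_add_distrib]
      map_smul' := fun a c => by
        rw [RingHom.id_apply, Finset.smul_sum]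
        exact Finset.sum_congr rfl fun b _ => by
          rw [MvPolynomial.smul_monomial]; rfl }
  let Φ : (exponentsBelow s (w + 1) → degreeLT F A) →ₗ[F] (ι × exponentsBelow s r × Fin r → F) :=
    { toFun := fun c k => (taylor (x k.1) ((MvPolynomial.aeval (fun j =>
        (MvPolynomial.X j + MvPolynomial.C (C (y k.1 j)) : MvPolynomial (Fin s) F[X]))
          (p c)).coeff k.2.1)).coeff k.2.2
      map_add' := fun c c' => by ext k; simp
      map_smul' := fun a c => by
        ext k
        rw [map_smul, ← algebraMap_smul F[X] a (p c), map_smul, MvPolynomial.coeff_smul,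
          algebraMap_smul, map_smul]
        simp }
  have hker : LinearMap.ker Φ ≠ ⊥ := by
    apply LinearMap.ker_ne_bot_of_finrank_lt
    have hA : Module.finrank F (degreeLT F A) = A := by
      rw [(degreeLTEquiv F A).finrank_eq, Module.finrank_fin_fun]
    rw [Module.finrank_fintype_fun_eq_card, Module.finrank_pi_fintype]
    simp only [hA, Finset.sum_const, Finset.card_univ, Fintype.card_coe, Fintype.card_prod,
      Fintype.card_fin, smul_eq_mul, card_exponentsBelow_succ]
    refine lt_of_le_of_lt ?_ hcount
    -- The exact number of exponents below `r` is replaced by the larger number of those up to `r`,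
    -- which avoids a subtraction.
    refine Nat.mul_le_mul_left _ (Nat.mul_le_mul_right _ ?_)
    rw [← card_exponentsBelow_succ]
    exact Finset.card_le_card (exponentsBelow_mono (by omega))
  obtain ⟨c, hc, hc0⟩ := Submodule.exists_mem_ne_zero_of_ne_bot hker
  refine ⟨fun b => if h : b ∈ exponentsBelow s (w + 1) then c ⟨b, h⟩ else 0, ?_, ?_, ?_⟩
  · obtain ⟨b, hb⟩ := Function.ne_iff.1 hc0
    refine ⟨b, b.2, ?_⟩
    simpa using hb
  · intro b
    dsimp only
    split_ifs with h
    · exact mem_degreeLT.1 (c ⟨b, h⟩).2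
    · simp
  · intro k g hg
    have := X_sub_C_pow_dvd_aeval (p c) r (x k) (y k)
      (fun d hd i hi => congrFun hc (k, ⟨d, hd⟩, ⟨i, hi⟩)) g hg
    convert this using 1
    have hpc : p c = ∑ b : exponentsBelow s (w + 1),
        MvPolynomial.monomial (b : Fin s →₀ ℕ) (c b : F[X]) := rfl
    rw [hpc, map_sum, ← Finset.sum_coe_sort]
    refine Finset.sum_congr rfl fun b _ => ?_
    dsimp only
    rw [dif_pos b.2, MvPolynomial.aeval_monomial, Finsupp.prod_fintype _ _ (by simp)]
    rfl

end

/-! ### Polynomials with functional equations -/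

section

variable {F : Type} [Field F] [Fintype F] {K : Type} [Field K] [Algebra F K] {γ : F} {α : K}

theorem aeval_pow_card_pow (f : F[X]) (j : ℕ) :
    aeval α f ^ Fintype.card F ^ j = aeval (α ^ Fintype.card F ^ j) f := by
  induction j with
  | zero => simp
  | succ j ih =>
    rw [pow_succ, pow_mul, ih, ← map_pow, ← FiniteField.expand_card, expand_aeval, pow_mul]

theorem pow_card_pow_eq (hα : α ^ Fintype.card F = algebraMap F K γ * α) (j : ℕ) :
    α ^ Fintype.card F ^ j = algebraMap F K (γ ^ j) * α := by
  induction j with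
  | zero => simp
  | succ j ih =>
    rw [pow_succ, pow_mul, ih, mul_pow, ← map_pow, FiniteField.pow_card, hα, pow_succ, map_mul,
      mul_assoc]

/-- The conjugates of `α` are `γ ^ j * α`. -/
theorem aeval_ne_zero_of_degree_lt {N : ℕ} (hα : α ^ Fintype.card F = algebraMap F K γ * α)
    (hα0 : α ≠ 0) (hγ : ∀ i j, i < N → j < N → γ ^ i = γ ^ j → i = j) {f : F[X]} (hf : f ≠ 0)
    (hdeg : f.degree < N) : aeval α f ≠ 0 := by
  intro h
  -- Frobenius carries the root `α` to its `N` distinct conjugates, too many roots for the degree of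
  -- `f`.
  have hroot : ∀ j : Fin N, (f.map (algebraMap F K)).eval (algebraMap F K (γ ^ (j : ℕ)) * α) = 0 := by
    intro j
    rw [eval_map_algebraMap, ← pow_card_pow_eq hα, ← aeval_pow_card_pow, h,
      zero_pow (pow_ne_zero _ Fintype.card_ne_zero)]
  have hinj : Function.Injective fun j : Fin N => algebraMap F K (γ ^ (j : ℕ)) * α := by
    intro i j hij
    exact Fin.ext (hγ i j i.2 j.2 ((algebraMap F K).injective (mul_right_cancel₀ hα0 hij)))
  have hdeg' : (f.map (algebraMap F K)).natDegree < Fintype.card (Fin N) := by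
    rw [natDegree_map, Fintype.card_fin]
    exact (natDegree_lt_iff_degree_lt hf).2 hdeg
  have h0 := eq_zero_of_natDegree_lt_card_of_eval_eq_zero _ hinj hroot hdeg'
  exact hf ((Polynomial.map_eq_zero _).1 h0)

theorem sum_mul_pow_injOn {s q : ℕ} {b b' : Fin s → ℕ} (hb : ∀ j, b j < q) (hb' : ∀ j, b' j < q)
    (h : ∑ j, b j * q ^ (j : ℕ) = ∑ j, b' j * q ^ (j : ℕ)) : b = b' := by
  have := finFunctionFinEquiv.injective (a₁ := fun j => (⟨b j, hb j⟩ : Fin q))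
    (a₂ := fun j => ⟨b' j, hb' j⟩) (Fin.ext (by simpa [finFunctionFinEquiv_apply] using h))
  funext j
  exact congrArg Fin.val (congrFun this j)

/-- There are few polynomials `f` with `∑ b, p b * ∏ j, f (γ ^ j * X) ^ b j = 0`. -/
theorem exists_finset_aeval_mem {s w N : ℕ} (hα : α ^ Fintype.card F = algebraMap F K γ * α)
    (hα0 : α ≠ 0) (hγ : ∀ i j, i < N → j < N → γ ^ i = γ ^ j → i = j)
    (hw : w < Fintype.card F) {p : (Fin s →₀ ℕ) → F[X]}
    (hp : ∃ b ∈ exponentsBelow s (w + 1), p b ≠ 0) (hdeg : ∀ b, (p b).degree < N) :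
    ∃ T : Finset K, T.card ≤ w * Fintype.card F ^ (s - 1) ∧ ∀ f : F[X],
      ∑ b ∈ exponentsBelow s (w + 1), p b * ∏ j : Fin s, (f.comp (C (γ ^ (j : ℕ)) * X)) ^ b j = 0 →
        aeval α f ∈ T := by
  classical
  set q := Fintype.card F with hq
  have hq1 : 1 ≤ q := Fintype.card_pos
  set R : K[X] := ∑ b ∈ exponentsBelow s (w + 1),
    monomial (∑ j : Fin s, b j * q ^ (j : ℕ)) (aeval α (p b)) with hR
  -- No two monomials of `R` merge: the exponents `b j ≤ w < q` are the base-`q` digits of `∑ b j *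
  -- q ^ j`. The coefficient of a nonzero `p b` survives at `α`.
  have hR0 : R ≠ 0 := by
    obtain ⟨b, hb, hpb⟩ := hp
    have hcoeff : R.coeff (∑ j : Fin s, b j * q ^ (j : ℕ)) = aeval α (p b) := by
      rw [hR, finsetSum_coeff, Finset.sum_eq_single b]
      · simp
      · intro b' hb' hne
        rw [coeff_monomial, if_neg]
        intro heq
        have hlt : ∀ d : Fin s →₀ ℕ, d ∈ exponentsBelow s (w + 1) → ∀ j, d j < q := by
          intro d hd j
          have h1 := mem_exponentsBelow.1 hd
          have h2 := Finset.single_le_sum (f := fun j => d j) (fun _ _ => Nat.zero_le _)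
            (Finset.mem_univ j)
          omega
        exact hne (DFunLike.coe_injective (sum_mul_pow_injOn (hlt b' hb') (hlt b hb) heq))
      · exact fun h => absurd hb h
    intro h
    rw [h, coeff_zero] at hcoeff
    exact aeval_ne_zero_of_degree_lt hα hα0 hγ hpb (hdeg b) hcoeff.symm
  refine ⟨R.roots.toFinset, ?_, fun f hf => ?_⟩
  · refine (Multiset.toFinset_card_le _).trans ((card_roots' R).trans ?_)
    refine natDegree_sum_le_of_forall_le _ _ fun b hb => (natDegree_monomial_le _).trans ?_
    calc ∑ j : Fin s, b j * q ^ (j : ℕ) ≤ ∑ j : Fin s, b j * q ^ (s - 1) :=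
          Finset.sum_le_sum fun j _ => Nat.mul_le_mul_left _ (Nat.pow_le_pow_right hq1 (by omega))
      _ ≤ w * q ^ (s - 1) := by
          rw [← Finset.sum_mul]
          exact Nat.mul_le_mul_right _ (Nat.lt_succ_iff.1 (mem_exponentsBelow.1 hb))
  · rw [Multiset.mem_toFinset, mem_roots hR0, IsRoot.def, hR, eval_finsetSum]
    have h := congrArg (aeval α) hf
    rw [map_zero, map_sum] at h
    rw [← h]
    refine Finset.sum_congr rfl fun b _ => ?_
    rw [eval_monomial, map_mul, map_prod, ← Finset.prod_pow_eq_pow_sum]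
    congr 1
    refine Finset.prod_congr rfl fun j _ => ?_
    -- Here `f(γ^j α) = f(α) ^ (q^j)` turns the functional equation into `R(f(α)) = 0`.
    rw [map_pow, aeval_comp, mul_comm (b j), pow_mul, aeval_pow_card_pow, pow_card_pow_eq hα]
    simp

end

end

/-! ### List-recoverability -/

section

open Polynomial

/-- Take a `(q - 1)`-th root of `γ`. -/
theorem exists_pow_eq_mul_self {F : Type} [Field F] [Fintype F] (γ : Fˣ) :
    ∃ α : AlgebraicClosure F, α ^ Fintype.card F = algebraMap F (AlgebraicClosure F) γ * α ∧
      α ≠ 0 := by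
  have hcard : 1 < Fintype.card F := Fintype.one_lt_card
  obtain ⟨α, hα⟩ := IsAlgClosed.exists_pow_nat_eq
    (algebraMap F (AlgebraicClosure F) (γ : F)) (n := Fintype.card F - 1) (by omega)
  refine ⟨α, ?_, ?_⟩
  · rw [← hα, ← pow_succ, Nat.sub_add_cancel hcard.le]
  · rintro rfl
    rw [zero_pow (by omega)] at hα
    exact γ.ne_zero ((map_eq_zero _).1 hα.symm)

open Classical in
/-- A list-recovery bound with explicit parameters: words of `s` consecutive letters, interpolation
with multiplicity `r` and degree `w`. -/
theorem ncard_frsCode_le {t : ℕ} {F : Type} [Field F] [Fintype F] {γ : Fˣ}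
    (hcard : Fintype.card F = 2 ^ (2 * t)) (hγ : ∀ x : Fˣ, x ∈ Subgroup.zpowers γ)
    {s r w L l : ℕ} (hL : L + s = foldParam t + 1) (hw : w < Fintype.card F)
    (hcount : rsLen t * l * ((r + s).choose s * r) < (w + s).choose s * rsLen t)
    (hLle : L ≤ foldParam t)
    (S : Fin (codeLen t) → Finset (Fin (foldParam t) → F)) (hS : ∀ i, (S i).card ≤ l) :
    {x ∈ frsCode t γ | rsLen t + rsLen t / 10 * w ≤
      r * (L * (Finset.univ.filter fun i => x i ∈ S i).card)}.ncard ≤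
        w * Fintype.card F ^ (s - 1) := by
  set N := rsLen t with hN
  have hNq : N + 1 = Fintype.card F := by rw [hcard, hN, rsLen, codeLen_mul_foldParam_add_one]
  have hinj : ∀ i j, i < N → j < N → (γ : F) ^ i = (γ : F) ^ j → i = j := fun i j hi hj =>
    pow_inj_of_generator hγ (by omega) (by omega)
  obtain ⟨α, hα, hα0⟩ := exists_pow_eq_mul_self γ
  -- The exponent of `γ` at the start of a window: a block of `m` letters contains `L = m + 1 - s`
  -- windows of length `s`.
  let pt : Fin (codeLen t) × Fin L → ℕ := fun a => foldParam t * a.1 + a.2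
  have hpt : ∀ (i : Fin (codeLen t)) (l : Fin L) (j : Fin s) (h : (l : ℕ) + j < foldParam t),
      (finProdFinEquiv (i, (⟨l + j, h⟩ : Fin (foldParam t))) : ℕ) = pt (i, l) + j := by
    intro i l j h
    simp only [finProdFinEquiv_apply_val, pt]; ring
  let ι : Type := Σ a : Fin (codeLen t) × Fin L, S a.1
  let y : ι → Fin s → F := fun a j => (a.2 : Fin (foldParam t) → F) ⟨a.1.2 + j, by omega⟩
  have hι : Fintype.card ι ≤ N * l := by
    calc Fintype.card ι = ∑ a : Fin (codeLen t) × Fin L, (S a.1).card := by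
          simp [ι, Fintype.card_sigma]
      _ ≤ ∑ _a : Fin (codeLen t) × Fin L, l := Finset.sum_le_sum fun a _ => hS a.1
      _ = codeLen t * L * l := by simp
      _ ≤ N * l := Nat.mul_le_mul_right _ (Nat.mul_le_mul_left _ hLle)
  obtain ⟨p, hp0, hpdeg, hpdvd⟩ := exists_interpolant (fun a : ι => (γ : F) ^ pt a.1) y N w r
    ((Nat.mul_le_mul_right _ hι).trans_lt hcount)
  obtain ⟨T, hTcard, hT⟩ := exists_finset_aeval_mem (s := s) hα hα0 hinj hw hp0 hpdeg
  have hmain : ∀ x ∈ {x ∈ frsCode t γ | N + N / 10 * w ≤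
      r * (L * (Finset.univ.filter fun i => x i ∈ S i).card)},
      ∃ f : F[X], f.natDegree ≤ N / 10 ∧ x = foldWord (fun i => f.eval ((γ : F) ^ (i : ℕ))) ∧
        aeval α f ∈ T := by
    rintro x ⟨⟨x', ⟨f, hf, hx'⟩, rfl⟩, hagree⟩
    refine ⟨f, hf, congrArg foldWord (funext hx'), hT f ?_⟩
    set x := foldWord x' with hx
    set I := Finset.univ.filter fun i => x i ∈ S i with hI
    set G := ∑ b ∈ exponentsBelow s (w + 1),
      p b * ∏ j : Fin s, (f.comp (C ((γ : F) ^ (j : ℕ)) * X)) ^ b j with hG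
    by_contra hG0
    -- Each coefficient has degree less than `N`, and each of the at most `w` factors `f(γ^j X)`
    -- adds at most `N / 10`.
    have hdegG : G.natDegree < N + N / 10 * w := by
      have hlt : ∀ b ∈ exponentsBelow s (w + 1), (p b * ∏ j : Fin s,
          (f.comp (C ((γ : F) ^ (j : ℕ)) * X)) ^ b j).degree < (N + N / 10 * w : ℕ) := by
        intro b hb
        have hprod : (∏ j : Fin s, (f.comp (C ((γ : F) ^ (j : ℕ)) * X)) ^ b j).natDegree ≤
            N / 10 * w := by
          refine (natDegree_prod_le _ _).trans ?_
          calc ∑ j : Fin s, ((f.comp (C ((γ : F) ^ (j : ℕ)) * X)) ^ b j).natDegree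
              ≤ ∑ j : Fin s, b j * (N / 10) := by
                refine Finset.sum_le_sum fun j _ => natDegree_pow_le.trans
                  (Nat.mul_le_mul_left _ (natDegree_comp_le.trans ?_))
                refine le_trans (Nat.mul_le_mul_left _ ((natDegree_C_mul_le _ _).trans natDegree_X_le)) ?_
                rwa [mul_one]
            _ ≤ N / 10 * w := by
                rw [← Finset.sum_mul, mul_comm]
                exact Nat.mul_le_mul_left _ (Nat.lt_succ_iff.1 (mem_exponentsBelow.1 hb))
        by_cases hpb : p b = 0
        · rw [hpb, zero_mul, degree_zero]
          exact WithBot.bot_lt_coe _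
        · refine lt_of_le_of_lt degree_le_natDegree ?_
          have h1 := (natDegree_lt_iff_degree_lt hpb).2 (hpdeg b)
          have h2 := natDegree_mul_le (p := p b) (q := ∏ j : Fin s,
            (f.comp (C ((γ : F) ^ (j : ℕ)) * X)) ^ b j)
          exact Nat.cast_lt.2 (by omega)
      rw [natDegree_lt_iff_degree_lt hG0]
      exact (degree_sum_le _ _).trans_lt ((Finset.sup_lt_iff (WithBot.bot_lt_coe _)).2 hlt)
    -- Every agreeing block contributes `L` distinct zeros of order `r`, which together exceed the
    -- degree of `G`.
    have hdvd : ∏ a ∈ I ×ˢ (Finset.univ : Finset (Fin L)), (X - C ((γ : F) ^ pt a)) ^ r ∣ G := by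
      refine Finset.prod_dvd_of_coprime ?_ ?_
      · intro a _ a' _ hne
        refine IsCoprime.pow (pairwise_coprime_X_sub_C (s := fun a : Fin (codeLen t) × Fin L =>
          (γ : F) ^ pt a) ?_ hne)
        intro a a' h
        have hlt : ∀ a : Fin (codeLen t) × Fin L, pt a < N := fun a => by
          have h1 := (finProdFinEquiv (a.1, (⟨a.2, a.2.2.trans_le hLle⟩ : Fin (foldParam t)))).2
          have h2 : pt a < codeLen t * foldParam t := by
            simp only [finProdFinEquiv_apply_val] at h1
            simp only [pt]
            omega
          exact h2
        have h3 := hinj _ _ (hlt a) (hlt a') h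
        have h4 : finProdFinEquiv (a.1, (⟨a.2, a.2.2.trans_le hLle⟩ : Fin (foldParam t))) =
            finProdFinEquiv (a'.1, ⟨a'.2, a'.2.2.trans_le hLle⟩) := by
          apply Fin.ext
          simp only [finProdFinEquiv_apply_val]
          simp only [pt] at h3
          omega
        have h5 := finProdFinEquiv.injective h4
        exact Prod.ext (Prod.mk.inj h5).1 (Fin.ext (Fin.mk.inj (Prod.mk.inj h5).2))
      · rintro ⟨i, l⟩ hil
        have hi : x i ∈ S i := by
          have := (Finset.mem_product.1 hil).1
          simpa [hI] using this
        refine hpdvd (⟨(i, l), ⟨x i, hi⟩⟩ : ι) _ fun j => ?_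
        simp only [y, hx, foldWord]
        refine Eq.trans ?_ (hx' _).symm
        rw [hpt]
        simp only [eval_comp, eval_mul, eval_C, eval_X]
        rw [← pow_add, add_comm]
    have hle := natDegree_le_of_dvd hdvd hG0
    rw [natDegree_prod_of_monic _ _ fun a _ => (monic_X_sub_C _).pow r] at hle
    simp only [natDegree_pow, natDegree_X_sub_C, mul_one, Finset.sum_const, Finset.card_product,
      Finset.card_univ, Fintype.card_fin, smul_eq_mul] at hle
    have : I.card * L * r = r * (L * I.card) := by ring
    omega
  choose! f hfdeg hfx hfT using hmain
  refine le_trans ?_ hTcard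
  rw [← Set.ncard_coe_finset T]
  -- Two message polynomials with the same value at `α` coincide, as their difference has degree
  -- less than `N`.
  refine Set.ncard_le_ncard_of_injOn (fun x => aeval α (f x)) hfT ?_ T.finite_toSet
  intro x hx x' hx' h
  by_contra hne
  have hff : f x - f x' ≠ 0 := by
    intro h0
    apply hne
    rw [hfx x hx, hfx x' hx', sub_eq_zero.1 h0]
  have hN0 : 0 < N := by have : 1 < Fintype.card F := Fintype.one_lt_card; omega
  refine aeval_ne_zero_of_degree_lt hα hα0 hinj hff ?_ (by rw [map_sub, sub_eq_zero]; exact h)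
  rw [← natDegree_lt_iff_degree_lt hff]
  refine (natDegree_sub_le _ _).trans_lt (max_lt ?_ ?_)
  · exact (hfdeg x hx).trans_lt (by omega)
  · exact (hfdeg x' hx').trans_lt (by omega)

end

/-! ### Choice of the parameters -/

theorem two_pow_mul_choose_le (a k : ℕ) : 2 ^ k * a.choose k ≤ (2 * a).choose k := by
  have h : 2 ^ k * a.descFactorial k ≤ (2 * a).descFactorial k := by
    induction k with
    | zero => simp
    | succ k ih =>
      rw [Nat.descFactorial_succ, Nat.descFactorial_succ, pow_succ]
      calc 2 ^ k * 2 * ((a - k) * a.descFactorial k)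
          = (2 * (a - k)) * (2 ^ k * a.descFactorial k) := by ring
        _ ≤ (2 * a - k) * (2 * a).descFactorial k := Nat.mul_le_mul (by omega) ih
  rw [Nat.descFactorial_eq_factorial_mul_choose, Nat.descFactorial_eq_factorial_mul_choose,
    mul_left_comm] at h
  exact Nat.le_of_mul_le_mul_left h (Nat.factorial_pos k)

open Filter in
theorem exists_mul_pow_le_codeLen : ∃ t₀ : ℕ, 1 ≤ t₀ ∧ ∀ t, t₀ ≤ t → (8 * t) ^ 10 ≤ codeLen t := by
  have h := (tendsto_pow_const_div_const_pow_of_one_lt 10 (one_lt_two : (1 : ℝ) < 2)).eventually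
    (gt_mem_nhds (show (0 : ℝ) < 1 / (2 * 8 ^ 10) by positivity))
  obtain ⟨t₁, ht₁⟩ := eventually_atTop.1 h
  refine ⟨max t₁ 1, le_max_right _ _, fun t ht => ?_⟩
  have h1 := ht₁ t ((le_max_left _ _).trans ht)
  have h2 : 1 ≤ t := (le_max_right _ _).trans ht
  rw [div_lt_div_iff₀ (by positivity) (by positivity)] at h1
  have h3 : t ^ 10 * (2 * 8 ^ 10) < 1 * 2 ^ t := by exact_mod_cast h1
  have h4 := codeLen_add_one t
  have h5 : 2 ≤ 2 ^ t := by simpa using Nat.pow_le_pow_right (show 0 < 2 by omega) h2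
  rw [mul_pow]
  omega

/-- With `u = ⌈n ^ 0.8⌉` the parameters are `s = r = 2 u` and `w = 6 u`. Interpolation is possible
because `C(8u, 2u) ≥ 2^(2u) C(4u, 2u)` outweighs the list size `2 ^ u` times `2 u`. The agreement
suffices because `1 + 0.6 u ≤ 2 u * 0.9 * 0.4 = 0.72 u` once `u ≥ 9`. -/
theorem frsCode_isListRecoverable :
    ∃ t₀ : ℕ, ∀ (t : ℕ) (F : Type) [Field F] [Fintype F] (γ : Fˣ), t₀ ≤ t →
      Fintype.card F = 2 ^ (2 * t) → (∀ x : Fˣ, x ∈ Subgroup.zpowers γ) →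
        IsListRecoverable (frsCode t γ) 0.4
          ((2 : ℝ) ^ ((codeLen t : ℝ) ^ (0.8 : ℝ))) ((2 : ℝ) ^ ((codeLen t : ℝ) ^ (0.9 : ℝ))) := by
  classical
  obtain ⟨t₀, ht₀, hbig⟩ := exists_mul_pow_le_codeLen
  refine ⟨t₀, fun t F _ _ γ ht hcard hγ => ?_⟩
  have ht1 : 1 ≤ t := ht₀.trans ht
  set n := codeLen t with hn
  have hnt : n + 1 = 2 ^ t := codeLen_add_one t
  have hm : foldParam t = n + 2 := by rw [foldParam, ← hnt]
  have hN : rsLen t = n * (n + 2) := by rw [rsLen, ← hn, hm]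
  intro S hS
  -- All real powers of `n` that occur become integer powers of `y`, so the estimates are
  -- polynomial.
  set y : ℝ := (n : ℝ) ^ (0.1 : ℝ) with hy
  have hpow : ∀ k : ℕ, y ^ k = (n : ℝ) ^ (0.1 * k : ℝ) := fun k => by
    rw [hy, ← Real.rpow_natCast, ← Real.rpow_mul (Nat.cast_nonneg n)]
  have hy8 : (n : ℝ) ^ (0.8 : ℝ) = y ^ 8 := by rw [hpow]; norm_num
  have hy9 : (n : ℝ) ^ (0.9 : ℝ) = y ^ 9 := by rw [hpow]; norm_num
  have hy10 : (n : ℝ) = y ^ 10 := by rw [hpow]; norm_num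
  have hy0 : 0 ≤ y := by positivity
  have hyt : 8 * (t : ℝ) ≤ y := by
    refine le_of_pow_le_pow_left₀ (n := 10) (by norm_num) hy0 ?_
    rw [← hy10]
    exact_mod_cast hbig t ht
  have ht1' : (1 : ℝ) ≤ t := by exact_mod_cast ht1
  have hy1 : 8 ≤ y := by linarith
  set u := ⌈y ^ 8⌉₊ with hu
  have hu1 : y ^ 8 ≤ u := Nat.le_ceil _
  have hu2 : (u : ℝ) ≤ 2 * y ^ 8 := by
    have h1 : (u : ℝ) < y ^ 8 + 1 := Nat.ceil_lt_add_one (by positivity)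
    have h2 : (1 : ℝ) ≤ y ^ 8 := one_le_pow₀ (by linarith)
    linarith
  have hu9 : 9 ≤ u := by
    have h1 : (8 : ℝ) ^ 8 ≤ y ^ 8 := pow_le_pow_left₀ (by norm_num) hy1 8
    have h2 : (9 : ℝ) ≤ u := by linarith
    exact_mod_cast h2
  -- This makes windows of length `2 u` short compared with a block: at least `0.9 m'` of them fit,
  -- where `m' = n + 2` is the block length.
  have hun : 20 * u ≤ n := by
    have h1 : (64 : ℝ) ≤ y ^ 2 := by nlinarith
    have h2 : (20 * u : ℝ) ≤ n := by
      calc (20 * u : ℝ) ≤ 64 * y ^ 8 := by nlinarith [pow_nonneg hy0 8]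
        _ ≤ y ^ 2 * y ^ 8 := mul_le_mul_of_nonneg_right h1 (by positivity)
        _ = n := by rw [hy10]; ring
    exact_mod_cast h2
  set l := ⌊(2 : ℝ) ^ (n : ℝ) ^ (0.8 : ℝ)⌋₊ with hl
  have hSl : ∀ i, (S i).card ≤ l := fun i => Nat.le_floor (hS i)
  have hlu : l ≤ 2 ^ u := by
    refine Nat.floor_le_of_le ?_
    rw [hy8]
    push_cast
    rw [← Real.rpow_natCast 2 u]
    exact Real.rpow_le_rpow_of_exponent_le one_le_two hu1
  have htwo : 2 * u < 2 ^ u := by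
    have h : ∀ k, 9 ≤ k → 2 * k < 2 ^ k := fun k hk => by
      induction k, hk using Nat.le_induction with
      | base => norm_num
      | succ k hk ih => rw [pow_succ]; omega
    exact h u hu9
  have hN0 : 0 < rsLen t := by rw [hN]; exact Nat.mul_pos (by omega) (by omega)
  have hcount : rsLen t * l * ((2 * u + 2 * u).choose (2 * u) * (2 * u)) <
      (6 * u + 2 * u).choose (2 * u) * rsLen t := by
    have h1 := two_pow_mul_choose_le (2 * u + 2 * u) (2 * u)
    have h2 : l * (2 * u) < 2 ^ (2 * u) := by
      rw [two_mul u, pow_add, ← two_mul]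
      exact Nat.mul_lt_mul_of_le_of_lt hlu htwo (by positivity)
    have h3 : 0 < (2 * u + 2 * u).choose (2 * u) := Nat.choose_pos (by omega)
    calc rsLen t * l * ((2 * u + 2 * u).choose (2 * u) * (2 * u))
        = rsLen t * (l * (2 * u) * (2 * u + 2 * u).choose (2 * u)) := by ring
      _ < rsLen t * (2 ^ (2 * u) * (2 * u + 2 * u).choose (2 * u)) :=
          Nat.mul_lt_mul_of_pos_left (Nat.mul_lt_mul_of_pos_right h2 h3) hN0
      _ ≤ rsLen t * (2 * (2 * u + 2 * u)).choose (2 * u) := Nat.mul_le_mul_left _ h1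
      _ = (6 * u + 2 * u).choose (2 * u) * rsLen t := by
          rw [mul_comm, show 2 * (2 * u + 2 * u) = 6 * u + 2 * u by ring]
  have hNq : rsLen t + 1 = Fintype.card F := by
    rw [hcard, rsLen, codeLen_mul_foldParam_add_one]
  have hwq : 6 * u < Fintype.card F := by
    rw [← hNq, hN]
    nlinarith
  have hmain := ncard_frsCode_le (s := 2 * u) (r := 2 * u) (w := 6 * u) (L := foldParam t + 1 - 2 * u)
    (l := l) hcard hγ (by omega) hwq hcount (by omega) S hSl
  have hsub : {x ∈ frsCode t γ | (0.4 : ℝ) * n ≤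
      ((Finset.univ.filter fun i => x i ∈ S i).card : ℝ)} ⊆
      {x ∈ frsCode t γ | rsLen t + rsLen t / 10 * (6 * u) ≤
        2 * u * ((foldParam t + 1 - 2 * u) * (Finset.univ.filter fun i => x i ∈ S i).card)} := by
    rintro x ⟨hx, hagree⟩
    refine ⟨hx, ?_⟩
    set a := (Finset.univ.filter fun i => x i ∈ S i).card with ha
    have hk : ((rsLen t / 10 : ℕ) : ℝ) ≤ (rsLen t : ℝ) / 10 := by
      simpa using Nat.cast_div_le (α := ℝ) (m := rsLen t) (n := 10)
    have hNr : (rsLen t : ℝ) = n * (n + 2) := by rw [hN]; push_cast; ring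
    have hLr : ((foldParam t + 1 - 2 * u : ℕ) : ℝ) = n + 3 - 2 * u := by
      rw [Nat.cast_sub (by omega), hm]; push_cast; ring
    have hunr : (20 * u : ℝ) ≤ n := by exact_mod_cast hun
    have hur : (9 : ℝ) ≤ u := by exact_mod_cast hu9
    have hn0 : (0 : ℝ) ≤ n := Nat.cast_nonneg n
    have hreal : (rsLen t : ℝ) + ((rsLen t / 10 : ℕ) : ℝ) * (6 * u) ≤
        2 * u * (((foldParam t + 1 - 2 * u : ℕ) : ℝ) * a) := by
      calc (rsLen t : ℝ) + ((rsLen t / 10 : ℕ) : ℝ) * (6 * u)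
          ≤ rsLen t + (rsLen t : ℝ) / 10 * (6 * u) := by
            have := mul_le_mul_of_nonneg_right hk (show (0 : ℝ) ≤ 6 * u by positivity)
            linarith
        _ ≤ 2 * u * ((0.9 * (n + 2)) * (0.4 * n)) := by
            rw [hNr]
            have := mul_nonneg (mul_nonneg hn0 (show (0 : ℝ) ≤ n + 2 by positivity))
              (sub_nonneg.2 hur)
            norm_num
            nlinarith
        _ ≤ 2 * u * (((foldParam t + 1 - 2 * u : ℕ) : ℝ) * a) := by
            refine mul_le_mul_of_nonneg_left ?_ (by positivity)
            refine mul_le_mul ?_ hagree (by positivity) (by positivity)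
            rw [hLr]
            norm_num
            linarith
    exact_mod_cast hreal
  have hcardle : ({x ∈ frsCode t γ | (0.4 : ℝ) * n ≤
      ((Finset.univ.filter fun i => x i ∈ S i).card : ℝ)}.ncard : ℝ) ≤
        (2 : ℝ) ^ (n : ℝ) ^ (0.9 : ℝ) := by
    have h1 := (Set.ncard_le_ncard hsub (Set.toFinite _)).trans (hmain.trans
      (Nat.mul_le_mul_right _ hwq.le))
    rw [← pow_succ', Nat.sub_add_cancel (by omega), hcard, ← pow_mul] at h1
    refine (Nat.cast_le.2 h1).trans ?_
    push_cast
    rw [← Real.rpow_natCast 2, hy9]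
    refine Real.rpow_le_rpow_of_exponent_le one_le_two ?_
    push_cast
    -- The list has at most `q ^ (2u) = 2 ^ (4 t u)` elements; the constant `8` in `8 t ≤ y` is
    -- chosen so that the exponent is at most `y ^ 9`.
    calc 2 * (t : ℝ) * (2 * u) ≤ 2 * (y / 8) * (2 * (2 * y ^ 8)) := by
          refine mul_le_mul (by linarith) (by linarith) (by positivity) (by positivity)
      _ = y ^ 9 := by ring
  convert hcardle

theorem mainTheorem7 :
    -- list-recoverability, for all sufficiently large `n`
    (∃ t₀ : ℕ, ∀ (t : ℕ) (F : Type) [Field F] [Fintype F] (γ : Fˣ), t₀ ≤ t →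
      Fintype.card F = 2 ^ (2 * t) → (∀ x : Fˣ, x ∈ Subgroup.zpowers γ) →
        IsListRecoverable (frsCode t γ) 0.4
          ((2 : ℝ) ^ ((codeLen t : ℝ) ^ (0.8 : ℝ))) ((2 : ℝ) ^ ((codeLen t : ℝ) ^ (0.9 : ℝ)))) ∧
    -- unique decodability of the dual code by one machine in time polynomial in `n`
    (∃ (P : RAMProgram) (A B : ℕ) (c : ℝ) (t₀ : ℕ), 0 < c ∧
      ∀ (t : ℕ) (F : Type) [Field F] [Fintype F] (ν : F ≃ Fin (2 ^ (2 * t))) (γ : Fˣ),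
        (∀ x : Fˣ, x ∈ Subgroup.zpowers γ) →
        ∃ Decode : Word t F → Word t F,
          (∀ z : Word t F, P.OutputsWithin (A * codeLen t ^ B)
            (decoderInput ν γ z) (wordList ν (Decode z))) ∧
          (t₀ ≤ t → ∀ p : ℝ, 0 ≤ p → p ≤ 0.04 →
            1 - (2 : ℝ) ^ (-(c * (codeLen t : ℝ))) ≤
              errorProb p {e : Word t F | ∀ x ∈ dualCode (frsCode t γ), Decode (x + e) = x})) :=
  ⟨frsCode_isListRecoverable, dual_uniquely_decodable⟩
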